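/- For $a>-2$ let $P=P_a$, $P(x)=x^2+a$, let $\alpha_0=\frac{1-\sqrt{1-4a}}{2}$ (a fixed point of $P$), $\alpha_{i+1}=-\sqrt{-\alpha_i-a}$ for $i\ge 0$, and $I_\epsilon=[\alpha_0,-\alpha_0]$. Let $M$ be the minimal integer $m\ge 0$ with $P^m(a)\in I_\epsilon$, and assume that $M\ge 10^6$ (so that $a$ is close to $-2$). A *piece* is a pair $(I,n)$ of a segment $I\subset\mathbb R$ with non-empty interior and an integer $n\ge0$ such that $P^n|_I$ is a diffeomorphism onto its image, $P^n(I)\subset I_\epsilon$, and both endpoints of $I$ are preimages (by iterates of $P$) of $\alpha_0$ but not of $0$. It is a *puzzle piece* if $P^n(I)=I_\epsilon$. Put $(I,n)\star(I',n')=(I\cap P^{-n}(I'),\,n+n')$. For $2\le i\le M-1$ let $I_{s_-^i}\subset(-\infty,0]$ and $I_{s_+^i}\subset[0,\infty)$ be the segments sent bijectively by $P$ onto $[\alpha_{i-1},\alpha_{i-2}]$; the puzzle pieces $(I_{s_\pm^i},i)$ are called *simple*. Write $s_\pm=(I_{s_\pm^2},2)$ and $s_-^{\star k}=s_-\star\cdots\star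 s_-$ ($k$ factors). A puzzle piece $(I,n)\ne(I_\epsilon,0)$ with $I\subset I_\epsilon$ is *prime* if there is no puzzle piece $(I',n')$ with $I\subsetneq I'\subsetneq I_\epsilon$. Every puzzle piece contained in $I_\epsilon$ is a $\star$-product of a unique finite sequence of prime puzzle pieces, its *prime decomposition*; the number of factors is its *depth*. A product $(I_1,n_1)\star\cdots\star(I_m,n_m)$ of puzzle pieces with $I_j\subset I_\epsilon$ is *strongly regular* if $$\sum_{j\le i,\ (I_j,n_j)\text{ not simple}} n_j\ \le\ 2^{-\sqrt M}\sum_{j\le i}n_j\qquad\text{for all } 1\le i\le m .$$ A puzzle piece with prime decomposition $(I_j,n_j)_{1\le j\le m}$ is *common* if for every $j\ge0$, with $m'=\left\lfloor\frac{n_1+\cdots+n_j}{12}+\frac M{24}\right\rfloor$, $$(I_{j+1},n_{j+1})\star\cdots\star(I_{j+m'},n_{j+m'})\ne s_-^{\star m'}\quad\text{if } j+m'\le m,$$ $$(I_{j+1},n_{j+1})\star\cdots\star(I_{j+m'+1},n_{j+m'+1})\ne s_+\star s_-^{\star m'}\quad\text{if } j+m'+1\le m .$$ The map $P$ is *strongly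 regular* if there is a sequence $(I_j,n_j)_{j\ge1}$ of puzzle pieces with $I_j\subsetneq I_\epsilon$ such that, with $(I^{(k)},n^{(k)})=(I_1,n_1)\star\cdots\star(I_k,n_k)$, for every $k\ge1$: (SR$_1$) $P^{M+1}(0)\in I^{(k)}$; (SR$_2$) the product $(I_1,n_1)\star\cdots\star(I_k,n_k)$ is strongly regular; (SR$_3$) the puzzle piece $(I^{(k)},n^{(k)})$ is common and has depth $k$. **Corollary 3.27.** If $P_a$ is strongly regular, then it satisfies the Collet–Eckmann condition $$\liminf_{n\to\infty}\frac1n\log|DP_a^n(a)|>0 .$$ -/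

import Mathlib

namespace QuadPuzzle

/-- The quadratic map `P_a(x) = x ^ 2 + a`. -/
def P (a x : ℝ) : ℝ := x ^ 2 + a

/-- The fixed point `α₀` of `P_a` (the smaller one; it is close to `-1` for `a` close to `-2`). -/
noncomputable def alpha0 (a : ℝ) : ℝ := (1 - √(1 - 4 * a)) / 2

/-- `α_i = -(P|ℝ⁺)^{-i}(-α₀)`; the inverse branch of `P_a` on `ℝ⁺` is `y ↦ √(y - a)`. -/
noncomputable def alpha (a : ℝ) : ℕ → ℝ
  | 0 => alpha0 a
  | i + 1 => -√(-alpha a i - a)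

/-- The segment `I_ε = [α₀, -α₀]`. -/
noncomputable def Ieps (a : ℝ) : Set ℝ := Set.Icc (alpha0 a) (-alpha0 a)

/-- `M` is the first time at which the critical value `a` enters `I_ε`: the minimal `M` such that
`P_a^M(a) ∈ I_ε`. -/
def IsFirstReturnTime (a : ℝ) (M : ℕ) : Prop :=
  (P a)^[M] a ∈ Ieps a ∧ ∀ m < M, (P a)^[m] a ∉ Ieps a

/-- A pair `(I, n)` of a set of reals and an order. -/
abbrev OrdSet : Type := Set ℝ × ℕ

/-- `x` may be an endpoint of a piece: it is a preimage of `α₀` and not a preimage of `0`. -/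
def IsAdmissibleEndpoint (a x : ℝ) : Prop :=
  (∃ k : ℕ, (P a)^[k] x = alpha0 a) ∧ ∀ k : ℕ, (P a)^[k] x ≠ 0

/-- Pieces `(I, n)` of `P_a`: `I` is a segment with non-empty interior whose endpoints are
preimages of `α₀` but not of `0`, and `P_a^n|I` is a diffeomorphism onto its image (injective with
nowhere vanishing derivative), which is contained in `I_ε`. -/
def IsPiece (a : ℝ) (p : OrdSet) : Prop :=
  (∃ l r : ℝ, l < r ∧ p.1 = Set.Icc l r ∧
    IsAdmissibleEndpoint a l ∧ IsAdmissibleEndpoint a r) ∧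
  Set.InjOn (P a)^[p.2] p.1 ∧
  (∀ x ∈ p.1, deriv (P a)^[p.2] x ≠ 0) ∧
  Set.MapsTo (P a)^[p.2] p.1 (Ieps a)

/-- Puzzle pieces: the pieces `(I, n)` such that `P_a^n` sends `I` onto `I_ε`. -/
def IsPuzzlePiece (a : ℝ) (p : OrdSet) : Prop :=
  IsPiece a p ∧ (P a)^[p.2] '' p.1 = Ieps a

/-- The neutral puzzle piece `(I_ε, 0)`. -/
noncomputable def neutral (a : ℝ) : OrdSet := (Ieps a, 0)

/-- The product `(I, n) ⋆ (I', n') = (I ∩ P_a^{-n}(I'), n + n')`. -/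
def star (a : ℝ) (p q : OrdSet) : OrdSet :=
  (p.1 ∩ (P a)^[p.2] ⁻¹' q.1, p.2 + q.2)

/-- The product `p₁ ⋆ ⋯ ⋆ p_m` of a list. The last factor `(I_ε, 0)` of the fold does not change a
product of pieces, since it is a right neutral element for them. -/
noncomputable def starProd (a : ℝ) (L : List OrdSet) : OrdSet :=
  L.foldr (star a) (neutral a)

/-- The total order `n₁ + ⋯ + n_m` of a list. -/
def totalOrder (L : List OrdSet) : ℕ := (L.map Prod.snd).sum

/-- The pair of the segment `I_{s_-^i} ⊂ ℝ⁻`, sent bijectively by `P_a` onto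
`[α_{i-1}, α_{i-2}]`, and the order `i` (used for `2 ≤ i ≤ M - 1`). -/
noncomputable def sMinus (a : ℝ) (i : ℕ) : OrdSet :=
  ({x | x ≤ 0 ∧ P a x ∈ Set.Icc (alpha a (i - 1)) (alpha a (i - 2))}, i)

/-- The pair of the segment `I_{s_+^i} ⊂ ℝ⁺`, sent bijectively by `P_a` onto
`[α_{i-1}, α_{i-2}]`, and the order `i` (used for `2 ≤ i ≤ M - 1`). -/
noncomputable def sPlus (a : ℝ) (i : ℕ) : OrdSet :=
  ({x | 0 ≤ x ∧ P a x ∈ Set.Icc (alpha a (i - 1)) (alpha a (i - 2))}, i)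

/-- The simple puzzle pieces. -/
def IsSimplePiece (a : ℝ) (M : ℕ) (p : OrdSet) : Prop :=
  ∃ i : ℕ, 2 ≤ i ∧ i ≤ M - 1 ∧ (p = sMinus a i ∨ p = sPlus a i)

/-- Prime puzzle pieces: puzzle pieces `(I, n) ≠ (I_ε, 0)` with `I ⊆ I_ε` for which there is no
puzzle piece `(I', n')` with `I ⊊ I' ⊊ I_ε`. -/
def IsPrimePiece (a : ℝ) (p : OrdSet) : Prop :=
  IsPuzzlePiece a p ∧ p.1 ⊆ Ieps a ∧ p ≠ neutral a ∧
    ¬ ∃ q : OrdSet, IsPuzzlePiece a q ∧ p.1 ⊂ q.1 ∧ q.1 ⊂ Ieps a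

/-- `L` is the prime decomposition of `p`. -/
def IsPrimeDecomposition (a : ℝ) (L : List OrdSet) (p : OrdSet) : Prop :=
  (∀ q ∈ L, IsPrimePiece a q) ∧ starProd a L = p

/-- The puzzle piece `p` has depth `k`: its prime decomposition has `k` factors. -/
def HasDepth (a : ℝ) (p : OrdSet) (k : ℕ) : Prop :=
  ∃ L : List OrdSet, IsPrimeDecomposition a L p ∧ L.length = k

open Classical in
/-- The product of the list `L = (I₁, n₁), …, (I_m, n_m)` is strongly regular: the factors are
puzzle pieces with `I_j ⊆ I_ε`, and for every `1 ≤ i ≤ m` the sum of the `n_j` over the `j ≤ i`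
such that `(I_j, n_j)` is not simple is at most `2 ^ (-√M)` times the sum of the `n_j` over all
`j ≤ i`. -/
def IsStronglyRegularProduct (a : ℝ) (M : ℕ) (L : List OrdSet) : Prop :=
  (∀ q ∈ L, IsPuzzlePiece a q ∧ q.1 ⊆ Ieps a) ∧
  ∀ i : ℕ, 1 ≤ i → i ≤ L.length →
    (totalOrder ((L.take i).filter fun q => ¬ IsSimplePiece a M q) : ℝ) ≤
      (2 : ℝ) ^ (-√(M : ℝ)) * (totalOrder (L.take i) : ℝ)

/-- `ℵ(k) = ⌊k / 12 + M / 24⌋`. -/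
noncomputable def aleph (M k : ℕ) : ℕ := ⌊(k : ℝ) / 12 + (M : ℝ) / 24⌋₊

/-- Common puzzle pieces: with `(I_j, n_j)`, `1 ≤ j ≤ m`, the prime decomposition, for every
`j ≥ 0` and `m' = ℵ(n₁ + ⋯ + n_j)`, the product of the `m'` factors that follow the `j`-th one is
not `s_-^{⊙ m'}` (if there are that many), and the product of the `m' + 1` factors that follow the
`j`-th one is not `s_+ · s_-^{⊙ m'}` (if there are that many). -/
def IsCommon (a : ℝ) (M : ℕ) (p : OrdSet) : Prop :=
  IsPuzzlePiece a p ∧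
  ∃ L : List OrdSet, IsPrimeDecomposition a L p ∧
    ∀ j m' : ℕ, m' = aleph M (totalOrder (L.take j)) →
      (j + m' ≤ L.length →
        starProd a ((L.drop j).take m') ≠ starProd a (List.replicate m' (sMinus a 2))) ∧
      (j + m' + 1 ≤ L.length →
        starProd a ((L.drop j).take (m' + 1)) ≠
          starProd a (sPlus a 2 :: List.replicate m' (sMinus a 2)))

/-- Strong regularity of `P_a`, where `M` is the first return time of the critical value. The
sequence of puzzle pieces is indexed from `0`, so its first `k` terms are `p 0, …, p (k - 1)`. -/
def IsStronglyRegular (a : ℝ) (M : ℕ) : Prop :=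
  ∃ p : ℕ → OrdSet,
    (∀ j, IsPuzzlePiece a (p j) ∧ (p j).1 ⊂ Ieps a) ∧
    ∀ k : ℕ, 1 ≤ k →
      (P a)^[M + 1] 0 ∈ (starProd a ((List.range k).map p)).1 ∧
      IsStronglyRegularProduct a M ((List.range k).map p) ∧
      IsCommon a M (starProd a ((List.range k).map p)) ∧
      HasDepth a (starProd a ((List.range k).map p)) k

/-- The Collet–Eckmann condition `liminf (1/n) log |DP_a^n(a)| > 0`. The lower limit is taken in
the extended reals. If `DP_a^n(a)` vanishes for some `n`, it vanishes for all larger `n`, and the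
convention `log 0 = 0` makes the condition false, as it should be. -/
def ColletEckmann (a : ℝ) : Prop :=
  0 < Filter.liminf
    (fun n : ℕ => (((1 / (n : ℝ)) * Real.log |deriv (P a)^[n] a| : ℝ) : EReal)) Filter.atTop

end QuadPuzzle

namespace QuadPuzzle

open Set Finset

/-! Let x = P^{M+1}(0). The nested pieces cut the orbit of x into blocks, block j starting in the
prime piece `p j` and lasting its order. Strong regularity leaves at most a proportion 2^{-√M} of
the time to non-simple blocks. It therefore suffices to have uniform growth on simple blocks and a
crude bound e^{-O(Mn)} on the derivative over any other block of order n, because M·2^{-√M} is tiny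
for M ≥ 10^6.

Simple blocks (`NearTwo.simple_expansion`): with b the other fixed point, b² - P(y)² = (y² + a +
b)(b² - y²). This telescopes along an orbit. Since a + b is small, the product of the y_k² is nearly
that of the y_k² + a + b, so |DP^i| ≥ (7/5)^i.

Other blocks (`NearTwo.branch_expansion`): the branch of P^n on a prime piece extends monotonically
past both ends until it reaches an iterate of 0, or the point ±b. If the first n iterates of 0 stay
at distance δ from ±α₀, each extension adds length at least δ to the image, and the cross-ratio
inequality `cross_ratio_le` gives |DP^n| ≥ δ²/4.

The value of δ comes from commonness (`StrongOrbit.le_dist`, `StrongOrbit.le_dist_critical`). A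
point very close to α₀ follows this fixed point for a long time, so its next pieces are all s_-;
near -α₀ they are s_+ and then s_-. Long strings of this kind are forbidden, whence δ = 16^{-5Mn}.

Together these give log|DP^N(x)| ≥ N/5 at the ends N of the blocks (`StrongOrbit.log_expansion`).
Blocks are short relative to N, up to an additive M, so the growth persists at all times
(`StrongOrbit.log_deriv_ge`). -/

/-! ### Iterates of P and the invariant interval [-b, b] -/

theorem hasDerivAt_iterate_P (a : ℝ) (n : ℕ) (x : ℝ) :
    HasDerivAt (P a)^[n] (∏ k ∈ range n, 2 * (P a)^[k] x) x := by
  induction n with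
  | zero => simpa using hasDerivAt_id x
  | succ n ih =>
    rw [Function.iterate_succ', prod_range_succ, mul_comm]
    have h : HasDerivAt (P a) (2 * (P a)^[n] x) ((P a)^[n] x) := by
      have h2 := (hasDerivAt_pow 2 ((P a)^[n] x)).add_const a
      simp only [Nat.cast_ofNat, Nat.add_one_sub_one, pow_one] at h2
      exact h2
    exact h.comp x ih

theorem deriv_iterate_P (a : ℝ) (n : ℕ) (x : ℝ) :
    deriv (P a)^[n] x = ∏ k ∈ range n, 2 * (P a)^[k] x :=
  (hasDerivAt_iterate_P a n x).deriv

theorem continuous_iterate_P (a : ℝ) (n : ℕ) : Continuous (P a)^[n] :=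
  continuous_iff_continuousAt.2 fun x => (hasDerivAt_iterate_P a n x).continuousAt

theorem deriv_iterate_P_add (a : ℝ) (m n : ℕ) (x : ℝ) :
    deriv (P a)^[m + n] x = deriv (P a)^[m] x * deriv (P a)^[n] ((P a)^[m] x) := by
  rw [deriv_iterate_P, deriv_iterate_P, deriv_iterate_P, prod_range_add]
  congr 1
  refine prod_congr rfl fun k _ => ?_
  rw [add_comm m k, Function.iterate_add_apply]

theorem P_neg (a x : ℝ) : P a (-x) = P a x := by simp [P]

theorem iterate_P_neg (a : ℝ) {n : ℕ} (hn : n ≠ 0) (x : ℝ) : (P a)^[n] (-x) = (P a)^[n] x := by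
  obtain ⟨m, rfl⟩ := Nat.exists_eq_succ_of_ne_zero hn
  simp [P_neg]

theorem iterate_P_neg_eq_zero_iff (a : ℝ) (n : ℕ) (x : ℝ) :
    (P a)^[n] (-x) = 0 ↔ (P a)^[n] x = 0 := by
  rcases eq_or_ne n 0 with rfl | hn
  · simp
  · rw [iterate_P_neg a hn]

/-- The parametrization of `P_a` by its repelling fixed point `b`, for `a` close to `-2`. -/
structure NearTwo (a b : ℝ) : Prop where
  param : a = b - b ^ 2
  alpha0_eq : alpha0 a = 1 - b
  lb : 199 / 100 ≤ b
  ub : b < 2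

variable {a b : ℝ}

theorem NearTwo.P_fixed (h : NearTwo a b) : P a b = b := by simp [P, h.param]

theorem NearTwo.P_alpha0 (h : NearTwo a b) : P a (alpha0 a) = alpha0 a := by
  rw [P, h.alpha0_eq]; linarith [h.param, sq_nonneg b]

theorem NearTwo.iterate_alpha0 (h : NearTwo a b) (n : ℕ) : (P a)^[n] (alpha0 a) = alpha0 a :=
  Function.iterate_fixed h.P_alpha0 n

theorem NearTwo.iterate_of_abs_eq (h : NearTwo a b) {n : ℕ} (hn : n ≠ 0) {x : ℝ}
    (hx : x = alpha0 a ∨ x = -alpha0 a) : (P a)^[n] x = alpha0 a := by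
  rcases hx with rfl | rfl
  · exact h.iterate_alpha0 n
  · rw [iterate_P_neg a hn, h.iterate_alpha0]

theorem NearTwo.iterate_fixed (h : NearTwo a b) (n : ℕ) : (P a)^[n] b = b :=
  Function.iterate_fixed h.P_fixed n

theorem NearTwo.mapsTo_P (h : NearTwo a b) : MapsTo (P a) (Icc (-b) b) (Icc (-b) b) := by
  rintro x ⟨h1, h2⟩
  have := h.lb; have := h.ub
  simp only [P, h.param, Set.mem_Icc]
  constructor <;> nlinarith [sq_nonneg x]

theorem NearTwo.mapsTo_iterate (h : NearTwo a b) (n : ℕ) :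
    MapsTo (P a)^[n] (Icc (-b) b) (Icc (-b) b) := h.mapsTo_P.iterate n

theorem NearTwo.Ieps_subset (h : NearTwo a b) : Ieps a ⊆ Icc (-b) b := by
  have := h.lb
  refine Icc_subset_Icc ?_ ?_ <;> rw [h.alpha0_eq] <;> linarith

theorem NearTwo.lipschitz (h : NearTwo a b) (n : ℕ) {x y : ℝ} (hx : x ∈ Icc (-b) b)
    (hy : y ∈ Icc (-b) b) : |(P a)^[n] x - (P a)^[n] y| ≤ 4 ^ n * |x - y| := by
  induction n with
  | zero => simp
  | succ n ih =>
    obtain ⟨h1, h2⟩ := h.mapsTo_iterate n hx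
    obtain ⟨h3, h4⟩ := h.mapsTo_iterate n hy
    have hb := h.ub
    rw [Function.iterate_succ_apply', Function.iterate_succ_apply']
    set u := (P a)^[n] x
    set v := (P a)^[n] y
    have e : P a u - P a v = (u + v) * (u - v) := by simp only [P]; ring
    have : |u + v| ≤ 4 := abs_le.2 ⟨by linarith, by linarith⟩
    rw [e, abs_mul, pow_succ]
    nlinarith [abs_nonneg (u - v), abs_nonneg (u + v)]

theorem NearTwo.abs_deriv_le (h : NearTwo a b) (n : ℕ) {x : ℝ} (hx : x ∈ Icc (-b) b) :
    |deriv (P a)^[n] x| ≤ 4 ^ n := by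
  rw [deriv_iterate_P, abs_prod]
  calc ∏ k ∈ range n, |2 * (P a)^[k] x| ≤ ∏ k ∈ range n, (4 : ℝ) := by
        refine prod_le_prod (fun _ _ => abs_nonneg _) fun k _ => ?_
        obtain ⟨h1, h2⟩ := h.mapsTo_iterate k hx
        have := h.ub
        exact abs_le.2 ⟨by linarith, by linarith⟩
    _ = 4 ^ n := by simp

/-! ### Monotone branches and the cross-ratio inequality -/

theorem deriv_iterate_ne_zero_iff (a : ℝ) (n : ℕ) (x : ℝ) :
    deriv (P a)^[n] x ≠ 0 ↔ ∀ k < n, (P a)^[k] x ≠ 0 := by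
  simp [deriv_iterate_P, prod_ne_zero_iff]

/-- Zeros are excluded only in the open interval, so this also covers maximal branches, which end at
critical points. -/
theorem strictMonoOn_or_strictAntiOn {n : ℕ} {l r : ℝ}
    (h : ∀ k < n, ∀ x ∈ Ioo l r, (P a)^[k] x ≠ 0) :
    StrictMonoOn (P a)^[n] (Icc l r) ∨ StrictAntiOn (P a)^[n] (Icc l r) := by
  have hne : ∀ x ∈ Ioo l r, ∏ k ∈ range n, 2 * (P a)^[k] x ≠ 0 := fun x hx => by
    rw [← deriv_iterate_P, deriv_iterate_ne_zero_iff]; exact fun k hk => h k hk x hx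
  rcases hasDerivWithinAt_forall_lt_or_forall_gt_of_forall_ne (convex_Ioo l r)
    (fun x _ => (hasDerivAt_iterate_P a n x).hasDerivWithinAt) hne with h1 | h1
  · right
    refine strictAntiOn_of_deriv_neg (convex_Icc l r) (continuous_iterate_P a n).continuousOn ?_
    intro x hx
    rw [interior_Icc] at hx
    rw [deriv_iterate_P]; exact h1 x hx
  · left
    refine strictMonoOn_of_deriv_pos (convex_Icc l r) (continuous_iterate_P a n).continuousOn ?_
    intro x hx
    rw [interior_Icc] at hx
    rw [deriv_iterate_P]; exact h1 x hx

/-- The right side minus the left, without absolute values, is exactly (B - A)(C - B). This is the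
one-step form of cross-ratio expansion for the square map. -/
theorem abs_add_mul_abs_add_le {A B C : ℝ} (hB : (B - A) * (C - B) ≥ 0) (hAC : 0 ≤ A * C) :
    |C + B| * |B + A| ≤ 2 * |B| * |C + A| := by
  have key : (C + B) * (B + A) ≤ 2 * B * (C + A) := by nlinarith
  have h1 : 0 ≤ (C + B) * (B + A) := by
    rcases le_total 0 A with hA | hA <;> rcases le_total 0 C with hC | hC
    · nlinarith [sq_nonneg B, mul_nonneg hA hC, sq_nonneg (B - A), sq_nonneg (C - B), sq_nonneg (C-A)]
    · nlinarith [sq_nonneg B, sq_nonneg (A + C), sq_nonneg (A + B)]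
    · nlinarith [sq_nonneg B, sq_nonneg (A + C), sq_nonneg (A + B)]
    · nlinarith [sq_nonneg B, sq_nonneg (A + C), sq_nonneg (A + B)]
  calc |C + B| * |B + A| = (C + B) * (B + A) := by rw [← abs_mul, abs_of_nonneg h1]
    _ ≤ 2 * B * (C + A) := key
    _ ≤ |2 * B * (C + A)| := le_abs_self _
    _ = 2 * |B| * |C + A| := by rw [abs_mul, abs_mul]; simp

/-- A branch of an iterate of `P_a` expands cross-ratios. -/
theorem cross_ratio_le {n : ℕ} {l y r : ℝ} (hl : l < y) (hr : y < r)
    (h : ∀ k < n, ∀ x ∈ Ioo l r, (P a)^[k] x ≠ 0) :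
    |(P a)^[n] r - (P a)^[n] y| * |(P a)^[n] y - (P a)^[n] l| * (r - l) ≤
      |deriv (P a)^[n] y| * |(P a)^[n] r - (P a)^[n] l| * ((r - y) * (y - l)) := by
  induction n with
  | zero =>
    rw [deriv_iterate_P]
    simp only [Function.iterate_zero, id, range_zero, Finset.prod_empty, abs_one, one_mul]
    rw [abs_of_pos (sub_pos.2 hl), abs_of_pos (sub_pos.2 hr), abs_of_pos (by linarith : 0 < r - l)]
    exact (by ring : (r - y) * (y - l) * (r - l) = (r - l) * ((r - y) * (y - l))).le
  | succ n ih =>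
    have ih := ih fun k hk => h k (by omega)
    have hmono := strictMonoOn_or_strictAntiOn (n := n) fun k hk => h k (by omega)
    have hAC : 0 ≤ (P a)^[n] l * (P a)^[n] r := by
      by_contra! hneg
      have h0 : ∃ x ∈ Ioo l r, (P a)^[n] x = 0 := by
        rcases mul_neg_iff.1 hneg with ⟨h1, h2⟩ | ⟨h1, h2⟩
        · exact intermediate_value_Ioo' (hl.trans hr).le
            (continuous_iterate_P a n).continuousOn ⟨h2, h1⟩
        · exact intermediate_value_Ioo (hl.trans hr).le
            (continuous_iterate_P a n).continuousOn ⟨h1, h2⟩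
      obtain ⟨x, hx, hx0⟩ := h0
      exact h n (by omega) x hx hx0
    have hB : ((P a)^[n] y - (P a)^[n] l) * ((P a)^[n] r - (P a)^[n] y) ≥ 0 := by
      have hlm : l ∈ Icc l r := ⟨le_rfl, by linarith⟩
      have hym : y ∈ Icc l r := ⟨hl.le, hr.le⟩
      have hrm : r ∈ Icc l r := ⟨by linarith, le_rfl⟩
      rcases hmono with h1 | h1
      · have := h1 hlm hym hl; have := h1 hym hrm hr; nlinarith
      · have := h1 hlm hym hl; have := h1 hym hrm hr; nlinarith
    have key := abs_add_mul_abs_add_le hB hAC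
    have hD : |deriv (P a)^[n + 1] y| = |deriv (P a)^[n] y| * (2 * |(P a)^[n] y|) := by
      rw [deriv_iterate_P, prod_range_succ, ← deriv_iterate_P, abs_mul, abs_mul]; simp
    rw [hD]
    simp only [Function.iterate_succ_apply']
    set A := (P a)^[n] l
    set B := (P a)^[n] y
    set C := (P a)^[n] r
    -- The differences are handled by the induction hypothesis and the sums by `key`.
    have e : ∀ u v, P a u - P a v = (u - v) * (u + v) := fun u v => by simp only [P]; ring
    rw [e, e, e, abs_mul, abs_mul, abs_mul]
    calc |C - B| * |C + B| * (|B - A| * |B + A|) * (r - l)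
        = (|C - B| * |B - A| * (r - l)) * (|C + B| * |B + A|) := by ring
      _ ≤ (|deriv (P a)^[n] y| * |C - A| * ((r - y) * (y - l))) * (2 * |B| * |C + A|) := by
          have : 0 ≤ r - l := by linarith
          have : 0 ≤ (r - y) * (y - l) := mul_nonneg (by linarith) (by linarith)
          gcongr
      _ = _ := by ring

end QuadPuzzle

namespace QuadPuzzle

open Set Finset

variable {a b : ℝ}

/-! ### The parameter is close to `-2` -/

/-- Only b ≥ 3/2 is assumed here and in the next lemmas, because they serve to establish `NearTwo`.
-/
theorem alpha_add_bounds (hab : a = b - b ^ 2) (h0 : alpha0 a = 1 - b) (hb : 3 / 2 ≤ b) (k : ℕ) :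
    alpha a k ≤ 1 - b ∧ 0 < alpha a k + b := by
  induction k with
  | zero => rw [alpha, h0]; constructor <;> linarith
  | succ k ih =>
    obtain ⟨h1, h2⟩ := ih
    rw [alpha]
    have e1 : b - 1 ≤ √(-alpha a k - a) := Real.le_sqrt_of_sq_le (by nlinarith)
    have e2 : √(-alpha a k - a) < b := by
      rw [Real.sqrt_lt' (by linarith)]; nlinarith
    constructor <;> linarith

theorem alpha_succ_sq (hab : a = b - b ^ 2) (h0 : alpha0 a = 1 - b) (hb : 3 / 2 ≤ b) (k : ℕ) :
    alpha a (k + 1) ^ 2 = -alpha a k - a := by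
  have := (alpha_add_bounds hab h0 hb k).1
  rw [alpha, neg_sq, Real.sq_sqrt (by nlinarith)]

/-- The recursion reads (b - α_{k+1})(b + α_{k+1}) = α_k + b, and the first factor is at least 2b -
1 ≥ 2. -/
theorem alpha_succ_add_le (hab : a = b - b ^ 2) (h0 : alpha0 a = 1 - b) (hb : 3 / 2 ≤ b) (k : ℕ) :
    alpha a (k + 1) + b ≤ (alpha a k + b) / 2 := by
  have h1 := alpha_succ_sq hab h0 hb k
  obtain ⟨h2, h3⟩ := alpha_add_bounds hab h0 hb (k + 1)
  nlinarith

theorem alpha_add_le (hab : a = b - b ^ 2) (h0 : alpha0 a = 1 - b) (hb : 3 / 2 ≤ b) (k : ℕ) :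
    alpha a k + b ≤ (1 / 2) ^ k := by
  induction k with
  | zero => rw [alpha, h0]; norm_num
  | succ k ih => rw [pow_succ]; linarith [alpha_succ_add_le hab h0 hb k]

theorem alpha_antitone (hab : a = b - b ^ 2) (h0 : alpha0 a = 1 - b) (hb : 3 / 2 ≤ b) :
    Antitone (alpha a) :=
  antitone_nat_of_succ_le fun k => by
    linarith [alpha_succ_add_le hab h0 hb k, (alpha_add_bounds hab h0 hb k).2]

/-- Before time M the orbit of P(a) stays to the right of -α₀. Pulling this back along the positive
branch gives a < α_{M-1}, so a + b = b(2 - b) is below 2^{-(M-1)}. One more halving of α_i + b gives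
the factor 2 in the last claim. -/
theorem IsFirstReturnTime.exists_nearTwo {M : ℕ} (hM : IsFirstReturnTime a M) (ha : -2 < a)
    (hlarge : 100 ≤ M) :
    ∃ b, NearTwo a b ∧ ∀ i, i + 2 ≤ M → 2 * (a + b) ≤ alpha a i + b := by
  obtain ⟨hin, hout⟩ := hM
  have hle : alpha0 a ≤ -alpha0 a := hin.1.trans hin.2
  have hs1 : 1 ≤ √(1 - 4 * a) := by unfold alpha0 at hle; linarith
  have hs2 : 1 ≤ 1 - 4 * a := by rwa [Real.one_le_sqrt] at hs1
  have hsq := Real.sq_sqrt (by linarith : 0 ≤ 1 - 4 * a)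
  set b := (1 + √(1 - 4 * a)) / 2 with hbdef
  have h0 : alpha0 a = 1 - b := by rw [alpha0, hbdef]; ring
  have hab : a = b - b ^ 2 := by rw [hbdef]; linarith
  have hb1 : 1 ≤ b := by linarith
  have hnot : ∀ m < M, alpha0 a ≤ (P a)^[m] a → b - 1 < (P a)^[m] a := fun m hm hge => by
    by_contra! hcon
    exact hout m hm ⟨hge, by rw [h0]; linarith⟩
  have hpos : ∀ m, m + 1 < M → b - 1 < (P a)^[m + 1] a := by
    intro m
    induction m with
    | zero =>
      intro h1
      refine hnot _ h1 ?_
      rw [h0]; simp only [zero_add, Function.iterate_one, P]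
      have : b - 1 ≤ -a := by nlinarith
      nlinarith
    | succ m ih =>
      intro h1
      refine hnot _ h1 ?_
      have := ih (by omega)
      rw [h0, Function.iterate_succ_apply', P]; nlinarith
  have hPa : b - 1 < a ^ 2 + a := by simpa [P] using hpos 0 (by omega)
  have ha1 : a < -1 := by nlinarith
  have hb : 3 / 2 ≤ b := by nlinarith
  have hal : ∀ k, k + 2 ≤ M → -alpha a k < (P a)^[M - 1 - k] a := by
    intro k
    induction k with
    | zero =>
      intro _
      have := hpos (M - 2) (by omega)
      rw [show M - 2 + 1 = M - 1 - 0 by omega] at this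
      rw [alpha, h0]; linarith
    | succ k ih =>
      intro hk
      have h1 := ih (by omega)
      rw [show M - 1 - k = (M - 1 - (k + 1)) + 1 by omega, Function.iterate_succ_apply', P] at h1
      have h2 := hpos (M - 1 - (k + 1) - 1) (by omega)
      rw [show M - 1 - (k + 1) - 1 + 1 = M - 1 - (k + 1) by omega] at h2
      have h3 := alpha_succ_sq hab h0 hb k
      have h4 := (alpha_add_bounds hab h0 hb (k + 1)).1
      nlinarith
  have haM : a < alpha a (M - 1) := by
    have h1 := hal (M - 2) (by omega)
    rw [show M - 1 - (M - 2) = 1 by omega, Function.iterate_one, P] at h1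
    have h3 := alpha_succ_sq hab h0 hb (M - 2)
    rw [show M - 2 + 1 = M - 1 by omega] at h3
    have h4 := (alpha_add_bounds hab h0 hb (M - 1)).1
    nlinarith
  refine ⟨b, ⟨hab, h0, ?_, by nlinarith⟩, fun i hi => ?_⟩
  · have h1 := alpha_add_le hab h0 hb (M - 1)
    have h2 : ((1 : ℝ) / 2) ^ (M - 1) ≤ (1 / 2) ^ 10 :=
      pow_le_pow_of_le_one (by norm_num) (by norm_num) (by omega)
    norm_num at h2
    nlinarith
  · have h1 := alpha_succ_add_le hab h0 hb i
    have h2 := alpha_antitone hab h0 hb (show i + 1 ≤ M - 1 by omega)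
    linarith

theorem NearTwo.alpha_le (h : NearTwo a b) (k : ℕ) : alpha a k ≤ 1 - b :=
  (alpha_add_bounds h.param h.alpha0_eq (by linarith [h.lb]) k).1

theorem NearTwo.alpha_succ_sq (h : NearTwo a b) (k : ℕ) :
    alpha a (k + 1) ^ 2 = -alpha a k - a :=
  QuadPuzzle.alpha_succ_sq h.param h.alpha0_eq (by linarith [h.lb]) k

/-! ### Expansion of the simple pieces -/

/-- Each step lowers the index by one: |w| ≥ -α_m implies P(w) ≥ -α_{m-1}. -/
theorem NearTwo.le_abs_iterate (h : NearTwo a b) {m k : ℕ} (hk : k ≤ m) {w : ℝ}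
    (hw : -alpha a m ≤ |w|) : b - 1 ≤ |(P a)^[k] w| := by
  induction k generalizing m w with
  | zero => simpa using (show b - 1 ≤ |w| by linarith [h.alpha_le m])
  | succ k ih =>
    obtain ⟨m, rfl⟩ : ∃ m', m = m' + 1 := ⟨m - 1, by omega⟩
    rw [Function.iterate_succ_apply]
    refine ih (m := m) (by omega) (le_trans ?_ (le_abs_self _))
    have h1 := h.alpha_succ_sq m
    have h2 := h.alpha_le (m + 1)
    have h3 := h.lb
    have h4 : alpha a (m + 1) ^ 2 ≤ w ^ 2 := by
      rw [← sq_abs w, ← neg_sq (alpha a (m + 1))]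
      exact pow_le_pow_left₀ (by linarith) hw 2
    rw [P]; linarith

/-- Telescoping of b² - P(y)² = (b + P(y))(b - P(y)), where b + P(y) = y² + a + b and b - P(y) = b²
- y². -/
theorem NearTwo.prod_iterate_sq (h : NearTwo a b) (n : ℕ) (y : ℝ) :
    (∏ k ∈ range n, (((P a)^[k] y) ^ 2 + (a + b))) * (b ^ 2 - y ^ 2) =
      b ^ 2 - ((P a)^[n] y) ^ 2 := by
  induction n with
  | zero => simp
  | succ n ih =>
    rw [prod_range_succ, mul_right_comm, ih, Function.iterate_succ_apply', P, h.param]; ring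

theorem NearTwo.simple_expansion (h : NearTwo a b) {i : ℕ} (h2i : 2 ≤ i)
    (hi : 2 * (a + b) ≤ alpha a (i - 1) + b) {y : ℝ}
    (hy : P a y ∈ Icc (alpha a (i - 1)) (alpha a (i - 2))) (hend : (P a)^[i] y ∈ Ieps a) :
    (7 / 5) ^ i ≤ |deriv (P a)^[i] y| := by
  have hlb := h.lb
  have hub := h.ub
  have hp := h.param
  obtain ⟨j, rfl⟩ : ∃ j, i = j + 2 := ⟨i - 2, by omega⟩
  have hη : 0 ≤ a + b := by nlinarith
  have hη' : a + b ≤ 2 / 100 := by nlinarith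
  -- After the first step the orbit has modulus at least b - 1 ≥ 0.99, which dwarfs a + b ≤ 0.02.
  have hz : ∀ k ∈ range (j + 1), (9 / 10) * (((P a)^[k + 1] y) ^ 2 + (a + b)) ≤
      ((P a)^[k + 1] y) ^ 2 := by
    intro k hk
    rw [Finset.mem_range] at hk
    have h1 : -alpha a j ≤ |P a y| := le_trans (neg_le_neg (by simpa using hy.2)) (neg_le_abs _)
    have h2 := h.le_abs_iterate (by omega : k ≤ j) h1
    rw [← Function.iterate_succ_apply] at h2
    rw [← sq_abs ((P a)^[k + 1] y)]
    nlinarith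
  -- The starting point may be close to 0, but P(y) ≥ α_{i-1} and the assumed gap force y² ≥ a + b.
  have hy0 : (1 / 2) * (y ^ 2 + (a + b)) ≤ y ^ 2 := by
    have := hy.1
    rw [P] at this
    have e : j + 2 - 1 = j + 1 := by omega
    rw [e] at this hi
    linarith
  have htel := h.prod_iterate_sq (j + 2) y
  have hnum : 298 / 100 ≤ b ^ 2 - ((P a)^[j + 2] y) ^ 2 := by
    obtain ⟨h1, h2⟩ := hend
    rw [h.alpha0_eq] at h1 h2
    nlinarith
  have hprod : (0 : ℝ) ≤ ∏ k ∈ range (j + 2), (((P a)^[k] y) ^ 2 + (a + b)) :=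
    prod_nonneg fun _ _ => by positivity
  have hlow : 7 / 10 ≤ ∏ k ∈ range (j + 2), (((P a)^[k] y) ^ 2 + (a + b)) := by
    nlinarith [mul_nonneg hprod (sq_nonneg y)]
  have hsq : (1 / 2) * (9 / 10) ^ (j + 1) *
      ∏ k ∈ range (j + 2), (((P a)^[k] y) ^ 2 + (a + b)) ≤
      ∏ k ∈ range (j + 2), ((P a)^[k] y) ^ 2 := by
    rw [prod_range_succ', prod_range_succ' (fun k => ((P a)^[k] y) ^ 2)]
    have h1 : ∏ k ∈ range (j + 1), ((9 / 10) * (((P a)^[k + 1] y) ^ 2 + (a + b))) ≤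
        ∏ k ∈ range (j + 1), ((P a)^[k + 1] y) ^ 2 :=
      prod_le_prod (fun _ _ => by positivity) hz
    rw [prod_mul_distrib, prod_const, card_range] at h1
    simp only [Function.iterate_zero, id]
    calc _ = ((9 / 10) ^ (j + 1) * ∏ k ∈ range (j + 1), (((P a)^[k + 1] y) ^ 2 + (a + b))) *
          ((1 / 2) * (y ^ 2 + (a + b))) := by ring
      _ ≤ _ := by
        refine mul_le_mul h1 hy0 (by positivity) (prod_nonneg fun _ _ => by positivity)
  have hD : |deriv (P a)^[j + 2] y| ^ 2 =
      4 ^ (j + 2) * ∏ k ∈ range (j + 2), ((P a)^[k] y) ^ 2 := by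
    rw [sq_abs, deriv_iterate_P, ← Finset.prod_pow]
    simp only [mul_pow]
    rw [prod_mul_distrib, prod_const, card_range]
    norm_num
  have hj : ((7 / 5 : ℝ) ^ (j + 2)) ^ 2 ≤ 4 ^ (j + 2) * ((1 / 2) * (9 / 10) ^ (j + 1) * (7 / 10)) := by
    have : ((49 / 25 : ℝ)) ^ j ≤ (18 / 5) ^ j := pow_le_pow_left₀ (by norm_num) (by norm_num) j
    calc ((7 / 5 : ℝ) ^ (j + 2)) ^ 2 = (49 / 25) ^ j * (49 / 25) ^ 2 := by
          rw [← pow_mul, mul_comm, pow_mul, pow_add]; norm_num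
      _ ≤ (18 / 5) ^ j * (126 / 25) := by gcongr; norm_num
      _ = (4 * (9 / 10)) ^ j * (126 / 25) := by norm_num
      _ = _ := by rw [mul_pow]; ring
  refine le_of_sq_le_sq ?_ (abs_nonneg _)
  rw [hD]
  refine hj.trans (mul_le_mul_of_nonneg_left ?_ (by positivity))
  exact le_trans (by gcongr) hsq

/-! ### Expansion of a branch whose critical values avoid `±α₀` -/

/-- The point r' is the first zero of an earlier iterate beyond r, whose image is an iterate of 0,
or b if there is no such zero. By monotonicity the gap between the images of r and r' bounds the gap
seen from y. -/
theorem NearTwo.exists_extension (h : NearTwo a b) {n : ℕ} {y r δ : ℝ}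
    (hyr : y ≤ r) (hr : r < b) (hne : ∀ k < n, ∀ x ∈ Icc y r, (P a)^[k] x ≠ 0)
    (hend : (P a)^[n] r = alpha0 a ∨ (P a)^[n] r = -alpha0 a)
    (hδ : δ ≤ 1 / 2)
    (hcrit : ∀ m, 1 ≤ m → m ≤ n →
      δ ≤ |(P a)^[m] 0 - alpha0 a| ∧ δ ≤ |(P a)^[m] 0 + alpha0 a|) :
    ∃ r', r < r' ∧ r' ≤ b ∧ (∀ k < n, ∀ x ∈ Ico y r', (P a)^[k] x ≠ 0) ∧
      δ ≤ |(P a)^[n] r' - (P a)^[n] y| := by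
  suffices H : ∃ r', r < r' ∧ r' ≤ b ∧ (∀ k < n, ∀ x ∈ Ico y r', (P a)^[k] x ≠ 0) ∧
      δ ≤ |(P a)^[n] r' - (P a)^[n] r| by
    obtain ⟨r', h1, h2, h3, h4⟩ := H
    refine ⟨r', h1, h2, h3, h4.trans ?_⟩
    have hy' : y ∈ Icc y r' := ⟨le_rfl, by linarith⟩
    have hr0 : r ∈ Icc y r' := ⟨hyr, h1.le⟩
    have hr' : r' ∈ Icc y r' := ⟨by linarith, le_rfl⟩
    rcases strictMonoOn_or_strictAntiOn (a := a) (n := n) (l := y) (r := r')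
      (fun k hk x hx => h3 k hk x ⟨hx.1.le, hx.2⟩) with hm | hm
    · have e1 := hm.monotoneOn hy' hr0 hyr
      have e2 := hm hr0 hr' h1
      rw [abs_of_pos (by linarith), abs_of_pos (by linarith)]; linarith
    · have e1 := hm.antitoneOn hy' hr0 hyr
      have e2 := hm hr0 hr' h1
      rw [abs_of_neg (by linarith), abs_of_neg (by linarith)]; linarith
  have hlb := h.lb
  have h0 := h.alpha0_eq
  set S : Set ℝ := Icc y b ∩ ⋃ k ∈ Finset.range n, {x | (P a)^[k] x = 0} with hS
  have hScl : IsCompact S := by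
    refine isCompact_Icc.inter_right ?_
    refine isClosed_biUnion_finset fun k _ => ?_
    exact isClosed_eq (continuous_iterate_P a k) continuous_const
  have hSmem : ∀ x, x ∈ S ↔ (y ≤ x ∧ x ≤ b) ∧ ∃ k < n, (P a)^[k] x = 0 := by
    intro x; simp [hS]
  rcases S.eq_empty_or_nonempty with hemp | hnemp
  · refine ⟨b, hr, le_rfl, fun k hk x hx h0 => ?_, ?_⟩
    · have : x ∈ S := (hSmem x).2 ⟨⟨hx.1, hx.2.le⟩, k, hk, h0⟩
      rw [hemp] at this; exact this
    · rw [h.iterate_fixed]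
      rcases hend with e | e <;> rw [e, h0] <;> refine hδ.trans (le_trans ?_ (le_abs_self _)) <;>
        linarith
  · obtain ⟨r', hr'S, hmin⟩ := hScl.exists_isLeast hnemp
    obtain ⟨⟨h1, h2⟩, k, hk, hk0⟩ := (hSmem r').1 hr'S
    refine ⟨r', ?_, h2, fun k hk x hx hx0 => ?_, ?_⟩
    · by_contra! hcon
      exact hne k hk r' ⟨h1, hcon⟩ hk0
    · have := hmin ((hSmem x).2 ⟨⟨hx.1, hx.2.le.trans h2⟩, k, hk, hx0⟩)
      linarith [hx.2]
    · have e : (P a)^[n] r' = (P a)^[n - k] 0 := by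
        rw [← hk0, ← Function.iterate_add_apply]; congr 2; omega
      have := hcrit (n - k) (by omega) (by omega)
      rw [e]
      rcases hend with e | e <;> rw [e]
      · exact this.1
      · rw [sub_neg_eq_add]; exact this.2

theorem NearTwo.branch_expansion (h : NearTwo a b) {n : ℕ} (hn : n ≠ 0) {l y r δ : ℝ}
    (hl : -b < l) (hly : l ≤ y) (hyr : y ≤ r) (hr : r < b)
    (hne : ∀ k < n, ∀ x ∈ Icc l r, (P a)^[k] x ≠ 0)
    (hendl : (P a)^[n] l = alpha0 a ∨ (P a)^[n] l = -alpha0 a)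
    (hendr : (P a)^[n] r = alpha0 a ∨ (P a)^[n] r = -alpha0 a)
    (hδ0 : 0 ≤ δ) (hδ : δ ≤ 1 / 2)
    (hcrit : ∀ m, 1 ≤ m → m ≤ n →
      δ ≤ |(P a)^[m] 0 - alpha0 a| ∧ δ ≤ |(P a)^[m] 0 + alpha0 a|) :
    δ ^ 2 / 4 ≤ |deriv (P a)^[n] y| := by
  obtain ⟨r', hr1, hr2, hr3, hr4⟩ := h.exists_extension hyr hr
    (fun k hk x hx => hne k hk x ⟨hly.trans hx.1, hx.2⟩) hendr hδ hcrit
  -- The left extension is the right one for the reflected branch, as P is even.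
  obtain ⟨l', hl1, hl2, hl3, hl4⟩ := h.exists_extension (y := -y) (r := -l) (by linarith)
    (by linarith)
    (fun k hk x hx => by
      rw [Ne, ← iterate_P_neg_eq_zero_iff]
      exact hne k hk (-x) ⟨by linarith [hx.2], by linarith [hx.1]⟩)
    (by rwa [iterate_P_neg a hn]) hδ hcrit
  have hzero : ∀ k < n, ∀ x ∈ Ioo (-l') r', (P a)^[k] x ≠ 0 := by
    intro k hk x hx
    rcases le_total y x with hxy | hxy
    · exact hr3 k hk x ⟨hxy, hx.2⟩
    · rw [Ne, ← iterate_P_neg_eq_zero_iff]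
      exact hl3 k hk (-x) ⟨by linarith, by linarith [hx.1]⟩
  have key := cross_ratio_le (a := a) (by linarith : -l' < y) (by linarith : y < r') hzero
  rw [iterate_P_neg a hn] at key
  have hb := h.ub
  obtain ⟨h1, h2⟩ := h.mapsTo_iterate n (show r' ∈ Icc (-b) b from ⟨by linarith, hr2⟩)
  obtain ⟨h3, h4⟩ := h.mapsTo_iterate n (show l' ∈ Icc (-b) b from ⟨by linarith, hl2⟩)
  have hT : |(P a)^[n] r' - (P a)^[n] l'| ≤ 4 := abs_le.2 ⟨by linarith, by linarith⟩
  have hlen : 0 < r' - -l' := by linarith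
  -- For nonnegative u, v with u + v ≤ 4, uv ≤ (u + v)²/4 ≤ u + v.
  have hLR : (r' - y) * (y - -l') ≤ r' - -l' := by nlinarith [sq_nonneg ((r' - y) - (y - -l'))]
  rw [abs_sub_comm, iterate_P_neg a hn] at hl4
  have hfin : δ ^ 2 * (r' - -l') ≤ (|deriv (P a)^[n] y| * 4) * (r' - -l') := by
    calc δ ^ 2 * (r' - -l') = δ * δ * (r' - -l') := by ring
      _ ≤ _ := by gcongr
      _ ≤ _ := key
      _ ≤ _ := by
        have : 0 ≤ (r' - y) * (y - -l') := mul_nonneg (by linarith) (by linarith)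
        gcongr
  have := le_of_mul_le_mul_right hfin hlen
  linarith

end QuadPuzzle

namespace QuadPuzzle

open Set

variable {a b : ℝ}

/-! ### Puzzle pieces are nested or have disjoint interiors -/

theorem IsPuzzlePiece.iterate_ne_zero {p : OrdSet} (hp : IsPuzzlePiece a p) {k : ℕ}
    (hk : k < p.2) {x : ℝ} (hx : x ∈ p.1) : (P a)^[k] x ≠ 0 :=
  (deriv_iterate_ne_zero_iff a p.2 x).1 (hp.1.2.2.1 x hx) k hk

theorem NearTwo.zero_mem (h : NearTwo a b) : (0 : ℝ) ∈ Ieps a := by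
  have := h.lb
  constructor <;> rw [h.alpha0_eq] <;> linarith

theorem IsPuzzlePiece.mapsTo {p : OrdSet} (hp : IsPuzzlePiece a p) :
    MapsTo (P a)^[p.2] p.1 (Ieps a) := hp.1.2.2.2

theorem IsPuzzlePiece.exists_eq_of_mem {p : OrdSet} (hp : IsPuzzlePiece a p) {y : ℝ}
    (hy : y ∈ Ieps a) : ∃ x ∈ p.1, (P a)^[p.2] x = y := by
  rw [← hp.2] at hy; exact hy

/-- The segment of a puzzle piece, with the values of `P_a^n` at its ends and in its interior. -/
theorem IsPuzzlePiece.exists_Icc {p : OrdSet} (hp : IsPuzzlePiece a p) :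
    ∃ l r, l < r ∧ p.1 = Icc l r ∧
      ((P a)^[p.2] l = alpha0 a ∨ (P a)^[p.2] l = -alpha0 a) ∧
      ((P a)^[p.2] r = alpha0 a ∨ (P a)^[p.2] r = -alpha0 a) ∧
      ∀ x ∈ Ioo l r, (P a)^[p.2] x ∈ Ioo (alpha0 a) (-alpha0 a) := by
  obtain ⟨l, r, hlr, hI, -, -⟩ := hp.1.1
  have hlm : l ∈ Icc l r := ⟨le_rfl, hlr.le⟩
  have hrm : r ∈ Icc l r := ⟨hlr.le, le_rfl⟩
  have hl := hp.mapsTo (hI ▸ hlm)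
  have hr := hp.mapsTo (hI ▸ hrm)
  have hle : alpha0 a ≤ -alpha0 a := hl.1.trans hl.2
  obtain ⟨s, hs, hs'⟩ := hp.exists_eq_of_mem (show alpha0 a ∈ Ieps a from ⟨le_rfl, hle⟩)
  obtain ⟨t, ht, ht'⟩ := hp.exists_eq_of_mem (show -alpha0 a ∈ Ieps a from ⟨hle, le_rfl⟩)
  rw [hI] at hs ht
  refine ⟨l, r, hlr, hI, ?_⟩
  rcases strictMonoOn_or_strictAntiOn (a := a) (n := p.2) (l := l) (r := r)
    (fun k hk x hx => hp.iterate_ne_zero hk (hI ▸ Ioo_subset_Icc_self hx)) with hm | hm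
  · have e1 := hm.monotoneOn hlm hs hs.1
    have e2 := hm.monotoneOn ht hrm ht.2
    refine ⟨Or.inl (le_antisymm (hs' ▸ e1) hl.1), Or.inr (le_antisymm hr.2 (ht' ▸ e2)), ?_⟩
    exact fun x hx => ⟨hl.1.trans_lt (hm hlm (Ioo_subset_Icc_self hx) hx.1),
      (hm (Ioo_subset_Icc_self hx) hrm hx.2).trans_le hr.2⟩
  · have e1 := hm.antitoneOn hlm ht ht.1
    have e2 := hm.antitoneOn hs hrm hs.2
    refine ⟨Or.inr (le_antisymm hl.2 (ht' ▸ e1)), Or.inl (le_antisymm (hs' ▸ e2) hr.1), ?_⟩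
    exact fun x hx => ⟨hr.1.trans_lt (hm (Ioo_subset_Icc_self hx) hrm hx.2),
      (hm hlm (Ioo_subset_Icc_self hx) hx.1).trans_le hl.2⟩

/-- An end of p lands on ±α₀ and then stays at α₀, so at the later time q.2 it is not in the open
interval (α₀, -α₀), where the interior of q lands. No end of p is thus interior to q. -/
theorem NearTwo.nested (h : NearTwo a b) {p q : OrdSet} (hp : IsPuzzlePiece a p)
    (hq : IsPuzzlePiece a q) (hpq : p.2 ≤ q.2) (hne : (p.1 ∩ q.1).Nontrivial) : q.1 ⊆ p.1 := by
  obtain ⟨u, ⟨hup, huq⟩, v, ⟨hvp, hvq⟩, huv⟩ := hne.exists_lt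
  obtain ⟨l, r, -, hI, hl, hr, -⟩ := hp.exists_Icc
  obtain ⟨l', r', -, hI', -, -, hint⟩ := hq.exists_Icc
  have hbd : ∀ x, ((P a)^[p.2] x = alpha0 a ∨ (P a)^[p.2] x = -alpha0 a) →
      (P a)^[q.2] x ∉ Ioo (alpha0 a) (-alpha0 a) := by
    intro x hx hmem
    obtain ⟨d, hd⟩ := Nat.exists_eq_add_of_le' hpq
    rw [hd, Function.iterate_add_apply] at hmem
    rcases eq_or_ne d 0 with rfl | hd0
    · rcases hx with e | e <;> rw [e] at hmem
      · exact hmem.1.ne rfl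
      · exact hmem.2.ne rfl
    · rw [h.iterate_of_abs_eq hd0 hx] at hmem
      exact hmem.1.ne rfl
  rw [hI] at hup hvp ⊢
  rw [hI'] at huq hvq ⊢
  refine Icc_subset_Icc ?_ ?_
  · by_contra! hc
    exact hbd l hl (hint l ⟨hc, (hup.1.trans_lt huv).trans_le hvq.2⟩)
  · by_contra! hc
    exact hbd r hr (hint r ⟨(huq.1.trans_lt huv).trans_le hvp.2, hc⟩)

theorem NearTwo.order_le (h : NearTwo a b) {p q : OrdSet} (hp : IsPuzzlePiece a p)
    (hq : IsPuzzlePiece a q) (hpq : p.1 = q.1) : q.2 ≤ p.2 := by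
  by_contra! hlt
  obtain ⟨t, ht, ht0⟩ := hp.exists_eq_of_mem h.zero_mem
  exact hq.iterate_ne_zero hlt (hpq ▸ ht) ht0

theorem NearTwo.ext_of_fst (h : NearTwo a b) {p q : OrdSet} (hp : IsPuzzlePiece a p)
    (hq : IsPuzzlePiece a q) (hpq : p.1 = q.1) : p = q :=
  Prod.ext hpq (le_antisymm (h.order_le hq hp hpq.symm) (h.order_le hp hq hpq))

theorem IsPuzzlePiece.order_pos {p : OrdSet} (hp : IsPuzzlePiece a p)
    (hlt : p.1 ⊂ Ieps a) : 0 < p.2 := by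
  by_contra! h0
  have h1 := hp.2
  rw [Nat.le_zero.1 h0, Function.iterate_zero, image_id] at h1
  exact hlt.ne h1

theorem NearTwo.prime_ssubset (h : NearTwo a b) {p : OrdSet} (hp : IsPrimePiece a p) :
    p.1 ⊂ Ieps a := by
  refine hp.2.1.ssubset_of_ne fun he => hp.2.2.1 (Prod.ext he ?_)
  by_contra! h0
  exact hp.1.iterate_ne_zero (Nat.pos_of_ne_zero h0) (x := 0) (he ▸ h.zero_mem) rfl

/-- Here p need not be prime, so pieces can be recognised as s_± without a separate proof that s_±
are prime. -/
theorem NearTwo.prime_eq_of_le (h : NearTwo a b) {p q : OrdSet} (hp : IsPuzzlePiece a p)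
    (hpI : p.1 ⊂ Ieps a) (hq : IsPrimePiece a q) (hpq : p.2 ≤ q.2)
    (hne : (p.1 ∩ q.1).Nontrivial) : q = p := by
  refine h.ext_of_fst hq.1 hp ?_
  by_contra! hc
  exact hq.2.2.2 ⟨p, hp, (h.nested hp hq.1 hpq hne).ssubset_of_ne hc, hpI⟩

theorem NearTwo.prime_eq (h : NearTwo a b) {p q : OrdSet} (hp : IsPrimePiece a p)
    (hq : IsPrimePiece a q) (hne : (p.1 ∩ q.1).Nontrivial) : p = q := by
  rcases le_total p.2 q.2 with hle | hle
  · exact (h.prime_eq_of_le hp.1 (h.prime_ssubset hp) hq hle hne).symm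
  · exact h.prime_eq_of_le hq.1 (h.prime_ssubset hq) hp hle (inter_comm _ _ ▸ hne)

/-! ### Uniqueness of prime decompositions -/

theorem starProd_subset_Ieps {L : List OrdSet} (hL : ∀ q ∈ L, q.1 ⊆ Ieps a) :
    (starProd a L).1 ⊆ Ieps a := by
  cases L with
  | nil => exact subset_rfl
  | cons q L => exact inter_subset_left.trans (hL q (by simp))

theorem starProd_singleton {q : OrdSet} (hq : IsPuzzlePiece a q) : starProd a [q] = q :=
  Prod.ext (inter_eq_left.2 hq.mapsTo) rfl

theorem starProd_append_subset {L L' : List OrdSet} (hL' : ∀ q ∈ L', q.1 ⊆ Ieps a) :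
    (starProd a (L ++ L')).1 ⊆ (starProd a L).1 := by
  induction L with
  | nil => exact starProd_subset_Ieps hL'
  | cons q L ih => exact inter_subset_inter_right _ (preimage_mono ih)

theorem subset_of_star_subset {q u v : OrdSet} (hq : IsPuzzlePiece a q) (hu : u.1 ⊆ Ieps a)
    (huv : (star a q u).1 ⊆ (star a q v).1) : u.1 ⊆ v.1 := by
  intro s hs
  obtain ⟨t, ht, rfl⟩ := hq.exists_eq_of_mem (hu hs)
  exact (huv ⟨ht, hs⟩).2

theorem star_left_cancel {q u v : OrdSet} (hq : IsPuzzlePiece a q) (hu : u.1 ⊆ Ieps a)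
    (hv : v.1 ⊆ Ieps a) (huv : star a q u = star a q v) : u = v := by
  refine Prod.ext (Subset.antisymm ?_ ?_) ?_
  · exact subset_of_star_subset hq hu (huv ▸ subset_rfl)
  · exact subset_of_star_subset hq hv (huv ▸ subset_rfl)
  · exact Nat.add_left_cancel (congrArg Prod.snd huv)

theorem starProd_append_left_cancel {L L₁ L₂ : List OrdSet} (hL : ∀ q ∈ L, IsPrimePiece a q)
    (h₁ : ∀ q ∈ L₁, q.1 ⊆ Ieps a) (h₂ : ∀ q ∈ L₂, q.1 ⊆ Ieps a)
    (he : starProd a (L ++ L₁) = starProd a (L ++ L₂)) : starProd a L₁ = starProd a L₂ := by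
  induction L with
  | nil => exact he
  | cons q L ih =>
    have hL' : ∀ q ∈ L, IsPrimePiece a q := fun q' hq' => hL q' (List.mem_cons_of_mem _ hq')
    have hsub : ∀ L₃ : List OrdSet, (∀ q ∈ L₃, q.1 ⊆ Ieps a) →
        (starProd a (L ++ L₃)).1 ⊆ Ieps a := fun L₃ h₃ =>
      starProd_subset_Ieps fun q' hq' =>
        (List.mem_append.1 hq').elim (fun hh => (hL' q' hh).2.1) (h₃ q')
    exact ih hL' (star_left_cancel (hL q (by simp)).1 (hsub _ h₁) (hsub _ h₂) he)

/-- The first factors overlap, hence agree by primality; applying their common branch removes them.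
-/
theorem NearTwo.prefix_of_starProd_subset (h : NearTwo a b) {L L' : List OrdSet}
    (hL : ∀ q ∈ L, IsPrimePiece a q) (hL' : ∀ q ∈ L', IsPrimePiece a q)
    (hsub : (starProd a L').1 ⊆ (starProd a L).1) (hnt : (starProd a L').1.Nontrivial)
    (hlen : L.length ≤ L'.length) : L <+: L' := by
  induction L generalizing L' with
  | nil => exact List.nil_prefix
  | cons q L ih =>
    cases L' with
    | nil => simp at hlen
    | cons q' L' =>
      have hq := hL q (by simp)
      have hq' := hL' q' (by simp)
      obtain rfl : q = q' := h.prime_eq hq hq'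
        (hnt.mono (subset_inter (hsub.trans inter_subset_left) inter_subset_left))
      have hL'' : ∀ q ∈ L', IsPrimePiece a q := fun q' hq' => hL' q' (List.mem_cons_of_mem _ hq')
      rw [List.prefix_cons_inj]
      refine ih (fun q' hq' => hL q' (List.mem_cons_of_mem _ hq')) hL'' ?_ ?_ (by simpa using hlen)
      · exact subset_of_star_subset hq.1
          (starProd_subset_Ieps fun q' hq' => (hL'' q' hq').2.1) hsub
      · obtain ⟨u, hu, v, hv, huv⟩ := hnt
        exact ⟨_, hu.2, _, hv.2, fun e => huv (hq.1.1.2.1 hu.1 hv.1 e)⟩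

theorem NearTwo.starProd_inj (h : NearTwo a b) {L L' : List OrdSet}
    (hL : ∀ q ∈ L, IsPrimePiece a q) (hL' : ∀ q ∈ L', IsPrimePiece a q)
    (he : starProd a L = starProd a L') (hnt : (starProd a L).1.Nontrivial) : L = L' := by
  wlog hlen : L.length ≤ L'.length generalizing L L'
  · exact (this hL' hL he.symm (he ▸ hnt) (le_of_not_ge hlen)).symm
  obtain ⟨T, rfl⟩ := h.prefix_of_starProd_subset hL hL' (he ▸ subset_rfl) (he ▸ hnt) hlen
  cases T with
  | nil => simp
  | cons q T =>
    exfalso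
    have hT : ∀ q' ∈ q :: T, IsPrimePiece a q' := fun q' hq' =>
      hL' q' (List.mem_append_right _ hq')
    have := starProd_append_left_cancel (L₁ := []) (L₂ := q :: T) hL (by simp)
      (fun q' hq' => (hT q' hq').2.1) (by simpa using he)
    have hss := h.prime_ssubset (hT q (by simp))
    refine hss.2 ?_
    have e : Ieps a = (starProd a (q :: T)).1 := congrArg Prod.fst this
    rw [e]
    exact inter_subset_left

theorem IsPuzzlePiece.nontrivial {p : OrdSet} (hp : IsPuzzlePiece a p) : p.1.Nontrivial := by
  obtain ⟨l, r, hlr, hI, -⟩ := hp.1.1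
  rw [hI]
  exact ⟨l, ⟨le_rfl, hlr.le⟩, r, ⟨hlr.le, le_rfl⟩, hlr.ne⟩

/-- The depth grows by exactly one with each factor: the decomposition of the longer product extends
the shorter list by a single prime, which left cancellation identifies with the new factor. -/
theorem NearTwo.prime_of_depth (h : NearTwo a b) {p : ℕ → OrdSet}
    (hp : ∀ j, IsPuzzlePiece a (p j) ∧ (p j).1 ⊂ Ieps a)
    (hpuz : ∀ k, 1 ≤ k → IsPuzzlePiece a (starProd a ((List.range k).map p)))
    (hdepth : ∀ k, 1 ≤ k → HasDepth a (starProd a ((List.range k).map p)) k) (k : ℕ) :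
    ∀ q ∈ (List.range k).map p, IsPrimePiece a q := by
  induction k with
  | zero => simp
  | succ k ih =>
    obtain ⟨L, ⟨hL, hLe⟩, hlen⟩ := hdepth (k + 1) (by omega)
    have hA : (List.range (k + 1)).map p = (List.range k).map p ++ [p k] := by
      simp [List.range_succ]
    have hpk : ∀ q ∈ [p k], q.1 ⊆ Ieps a := by simpa using (hp k).2.1
    have hnt : (starProd a L).1.Nontrivial := hLe ▸ (hpuz (k + 1) (by omega)).nontrivial
    obtain ⟨T, rfl⟩ := h.prefix_of_starProd_subset ih hL
      (by rw [hLe, hA]; exact starProd_append_subset hpk) hnt (by simp [hlen])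
    obtain ⟨q, rfl⟩ : ∃ q, T = [q] := by
      rw [← List.length_eq_one_iff]; simpa using hlen
    have hq : IsPrimePiece a q := hL q (by simp)
    have hqp := starProd_append_left_cancel ih (by simpa using hq.2.1) hpk (hLe.trans (by rw [hA]))
    rw [starProd_singleton hq.1, starProd_singleton (hp k).1] at hqp
    rw [hA, ← hqp]
    exact hL

theorem mem_starProd_getElem {L : List OrdSet} {x : ℝ} (hx : x ∈ (starProd a L).1) (j : ℕ)
    (hj : j < L.length) : (P a)^[totalOrder (L.take j)] x ∈ (L[j]).1 := by
  induction L generalizing x j with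
  | nil => simp at hj
  | cons q L ih =>
    cases j with
    | zero => exact hx.1
    | succ j =>
      have := ih hx.2 j (by simpa using hj)
      rw [← Function.iterate_add_apply] at this
      simpa [totalOrder, add_comm] using this

/-! ### The simple pieces of order two -/

theorem NearTwo.alpha0_admissible (h : NearTwo a b) {x : ℝ}
    (hx : x = alpha0 a ∨ x = -alpha0 a) : IsAdmissibleEndpoint a x := by
  have h0 : alpha0 a ≠ 0 := by have := h.lb; rw [h.alpha0_eq]; linarith
  refine ⟨⟨1, h.iterate_of_abs_eq one_ne_zero hx⟩, fun k => ?_⟩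
  rcases eq_or_ne k 0 with rfl | hk
  · rcases hx with rfl | rfl <;> simpa
  · rwa [h.iterate_of_abs_eq hk hx]

theorem NearTwo.P_alpha1 (h : NearTwo a b) : P a (alpha a 1) = -alpha0 a := by
  have := h.alpha_succ_sq 0
  simp only [alpha] at this ⊢
  rw [P]; linarith

theorem NearTwo.admissible_of_P_eq (h : NearTwo a b) {x : ℝ} (hx0 : x ≠ 0)
    (hx : P a x = alpha a 1) : IsAdmissibleEndpoint a x := by
  obtain ⟨⟨k, hk⟩, hne⟩ := h.alpha0_admissible (x := -alpha0 a) (Or.inr rfl)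
  refine ⟨⟨k + 2, by
    rw [Function.iterate_add_apply]; simp only [Function.iterate_succ_apply,
      Function.iterate_zero, id, hx, h.P_alpha1, hk]⟩, fun j => ?_⟩
  match j with
  | 0 => exact hx0
  | 1 =>
    have := h.alpha_le 1
    have := h.lb
    simp only [Function.iterate_one, hx]; linarith
  | j + 2 => simpa only [Function.iterate_succ_apply, hx, h.P_alpha1] using hne j

/-- The positive preimage of `α₁`. -/
theorem NearTwo.exists_sqrt (h : NearTwo a b) :
    ∃ s, 0 < s ∧ s < b - 5 / 4 ∧ s ^ 2 = alpha a 1 - a := by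
  have h3 := h.alpha_succ_sq 0
  obtain ⟨h1, h2⟩ := alpha_add_bounds h.param h.alpha0_eq (by linarith [h.lb]) 1
  simp only [zero_add, show alpha a 0 = alpha0 a from rfl, h.alpha0_eq] at h3
  have hlb := h.lb
  have hub := h.ub
  have hp := h.param
  have hfac : (alpha a 1 + b) * (b - alpha a 1) = 1 := by nlinarith
  have h4 : 1 / 4 ≤ alpha a 1 + b := by nlinarith
  have h5 : alpha a 1 + b ≤ 34 / 100 := by nlinarith
  have h6 : 0 < alpha a 1 - a := by nlinarith
  refine ⟨√(alpha a 1 - a), Real.sqrt_pos.2 h6, ?_, Real.sq_sqrt h6.le⟩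
  rw [Real.sqrt_lt' (by linarith)]
  nlinarith

/-- The sign σ = ±1 treats s_- and s_+ at once. -/
theorem NearTwo.isPuzzlePiece_two (h : NearTwo a b) {s : Set ℝ} {σ l r : ℝ}
    (hσ : σ ^ 2 = 1) (hs : ∀ x, x ∈ s ↔ 0 ≤ σ * x ∧ P a x ∈ Icc (alpha a 1) (alpha0 a))
    (hI : s = Icc l r) (hlr : l < r) (hl : IsAdmissibleEndpoint a l)
    (hr : IsAdmissibleEndpoint a r) : IsPuzzlePiece a (s, 2) := by
  have hlb := h.lb
  have h0 := h.alpha0_eq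
  have hα1 := h.alpha_le 1
  have hP1 := h.P_alpha1
  have hparam := h.param
  have hit : ∀ x, (P a)^[2] x = P a (P a x) := fun x => rfl
  have hmono : ∀ x ∈ s, x ≠ 0 := by
    rintro x hx rfl
    have := hl.2 0
    have := hr.2 0
    have h2 := ((hs 0).1 hx).2.1
    rw [hI] at hx
    rcases hx.1.lt_or_eq with h3 | h3
    · rcases hx.2.lt_or_eq with h4 | h4
      · have hl' := ((hs l).1 (hI ▸ ⟨le_rfl, hlr.le⟩)).1
        have hr' := ((hs r).1 (hI ▸ ⟨hlr.le, le_rfl⟩)).1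
        have hσ0 : σ ≠ 0 := by rintro rfl; norm_num at hσ
        rcases hσ0.lt_or_gt with h5 | h5 <;> nlinarith
      · simp_all
    · simp_all
  have hmap : MapsTo (P a)^[2] s (Ieps a) := by
    intro x hx
    obtain ⟨-, h1, h2⟩ := (hs x).1 hx
    rw [hit]
    unfold Ieps
    rw [← hP1, Set.mem_Icc, h0] at *
    set w := P a x
    simp only [P] at *
    constructor <;> nlinarith
  refine ⟨⟨⟨l, r, hlr, hI, hl, hr⟩, ?_, ?_, hmap⟩, ?_⟩
  · intro x hx y hy hxy
    simp only [hit] at hxy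
    obtain ⟨hx1, hx2, hx3⟩ := (hs x).1 hx
    obtain ⟨hy1, hy2, hy3⟩ := (hs y).1 hy
    have e1 : P a x = P a y := by
      have : (P a x) ^ 2 = (P a y) ^ 2 := by
        simpa only [P, add_left_inj] using hxy
      rcases sq_eq_sq_iff_eq_or_eq_neg.1 this with e | e
      · exact e
      · linarith
    have e2 : x ^ 2 = y ^ 2 := by simpa only [P, add_left_inj] using e1
    rcases sq_eq_sq_iff_eq_or_eq_neg.1 e2 with e | e
    · exact e
    · rw [e, mul_neg] at hx1
      have h1 : σ * y = 0 := by linarith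
      have h2 : σ ≠ 0 := by rintro rfl; norm_num at hσ
      exact absurd (by simpa [h2] using h1) (hmono y hy)
  · intro x hx
    rw [deriv_iterate_ne_zero_iff]
    intro k hk
    interval_cases k
    · exact hmono x hx
    · have := ((hs x).1 hx).2.2
      rw [Function.iterate_one]
      linarith
  · refine Subset.antisymm (image_subset_iff.2 hmap) fun y hy => ?_
    obtain ⟨hy1, hy2⟩ := hy
    rw [← hP1] at hy2
    rw [h0] at hy1
    have hya : 0 ≤ y - a := by nlinarith
    have hsq := Real.sq_sqrt hya
    have hpos := Real.sqrt_nonneg (y - a)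
    set w := -√(y - a) with hw
    have hw2 : w ^ 2 = y - a := by rw [hw, neg_sq, hsq]
    have hw3 : w ≤ alpha0 a := by rw [h0]; nlinarith
    have hw4 : alpha a 1 ≤ w := by rw [P] at hy2; nlinarith
    have hwa : 0 ≤ w - a := by
      obtain ⟨t, ht0, -, ht2⟩ := h.exists_sqrt
      linarith [sq_nonneg t]
    have hsq' := Real.sq_sqrt hwa
    have hPx : P a (σ * √(w - a)) = w := by
      rw [P, mul_pow, hσ, hsq']; ring
    refine ⟨σ * √(w - a), (hs _).2 ⟨?_, ?_⟩, ?_⟩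
    · rw [← mul_assoc, ← sq, hσ, one_mul]; exact Real.sqrt_nonneg _
    · rw [hPx]; exact ⟨hw4, hw3⟩
    · rw [hit, hPx, P, hw2]; ring

theorem NearTwo.sMinus_eq (h : NearTwo a b) {s : ℝ} (hs : 0 < s) (hs2 : s ^ 2 = alpha a 1 - a) :
    (sMinus a 2).1 = Icc (alpha0 a) (-s) := by
  have hlb := h.lb
  have hp := h.param
  ext x
  simp only [sMinus, P, mem_ofPred_eq, Set.mem_Icc, show alpha a (2 - 1) = alpha a 1 from rfl,
    show alpha a (2 - 2) = alpha0 a from rfl, h.alpha0_eq]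
  constructor
  · rintro ⟨h1, h2, h3⟩; constructor <;> nlinarith
  · rintro ⟨h1, h2⟩; refine ⟨?_, ?_, ?_⟩ <;> nlinarith

theorem NearTwo.sPlus_eq (h : NearTwo a b) {s : ℝ} (hs : 0 < s) (hs2 : s ^ 2 = alpha a 1 - a) :
    (sPlus a 2).1 = Icc s (-alpha0 a) := by
  have hlb := h.lb
  have hp := h.param
  ext x
  simp only [sPlus, P, mem_ofPred_eq, Set.mem_Icc, show alpha a (2 - 1) = alpha a 1 from rfl,
    show alpha a (2 - 2) = alpha0 a from rfl, h.alpha0_eq]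
  constructor
  · rintro ⟨h1, h2, h3⟩; constructor <;> nlinarith
  · rintro ⟨h1, h2⟩; refine ⟨?_, ?_, ?_⟩ <;> nlinarith

theorem NearTwo.sMinus_isPuzzlePiece (h : NearTwo a b) : IsPuzzlePiece a (sMinus a 2) := by
  obtain ⟨s, hs0, hs1, hs2⟩ := h.exists_sqrt
  refine h.isPuzzlePiece_two (σ := -1) (by norm_num) (fun x => ?_) (h.sMinus_eq hs0 hs2) ?_
    (h.alpha0_admissible (Or.inl rfl))
    (h.admissible_of_P_eq (by linarith) (by rw [P_neg, P, hs2]; ring))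
  · simp [alpha]
  · rw [h.alpha0_eq]; linarith

theorem NearTwo.sPlus_isPuzzlePiece (h : NearTwo a b) : IsPuzzlePiece a (sPlus a 2) := by
  obtain ⟨s, hs0, hs1, hs2⟩ := h.exists_sqrt
  refine h.isPuzzlePiece_two (σ := 1) (by norm_num) (fun x => ?_) (h.sPlus_eq hs0 hs2) ?_
    (h.admissible_of_P_eq (by linarith) (by rw [P, hs2]; ring))
    (h.alpha0_admissible (Or.inr rfl))
  · simp [alpha]
  · rw [h.alpha0_eq]; linarith

theorem NearTwo.sMinus_ssubset (h : NearTwo a b) : (sMinus a 2).1 ⊂ Ieps a := by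
  obtain ⟨s, hs0, hs1, hs2⟩ := h.exists_sqrt
  have := h.lb
  rw [h.sMinus_eq hs0 hs2, ssubset_iff_of_subset]
  · exact ⟨0, h.zero_mem, fun h0 => by linarith [h0.2]⟩
  · exact Icc_subset_Icc le_rfl (by rw [h.alpha0_eq]; linarith)

theorem NearTwo.sPlus_ssubset (h : NearTwo a b) : (sPlus a 2).1 ⊂ Ieps a := by
  obtain ⟨s, hs0, hs1, hs2⟩ := h.exists_sqrt
  have := h.lb
  rw [h.sPlus_eq hs0 hs2, ssubset_iff_of_subset]
  · exact ⟨0, h.zero_mem, fun h0 => by linarith [h0.1]⟩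
  · exact Icc_subset_Icc (by rw [h.alpha0_eq]; linarith) le_rfl

/-- Order 1 is impossible because P ≤ α₀ on I_ε, so -α₀ is not attained. -/
theorem NearTwo.two_le_order (h : NearTwo a b) {p : OrdSet} (hp : IsPrimePiece a p) :
    2 ≤ p.2 := by
  have h0 := hp.1.order_pos (h.prime_ssubset hp)
  by_contra! hlt
  have h1 : p.2 = 1 := by omega
  have hlb := h.lb
  have hpar := h.param
  obtain ⟨t, ht, hte⟩ := hp.1.exists_eq_of_mem
    (show -alpha0 a ∈ Ieps a from ⟨by rw [h.alpha0_eq]; linarith, le_rfl⟩)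
  rw [h1, Function.iterate_one, P, h.alpha0_eq] at hte
  obtain ⟨h2, h3⟩ := hp.2.1 ht
  rw [h.alpha0_eq] at h2 h3
  nlinarith

/-- The bound s < b - 5/4 says that s_- contains [α₀, α₀ + 1/4], so p overlaps it in a nondegenerate
segment. -/
theorem NearTwo.eq_sMinus (h : NearTwo a b) {p : OrdSet} (hp : IsPrimePiece a p) {z : ℝ}
    (hz : z ∈ p.1) (hd : |z - alpha0 a| < 1 / 4) : p = sMinus a 2 := by
  refine h.prime_eq_of_le h.sMinus_isPuzzlePiece h.sMinus_ssubset hp (h.two_le_order hp) ?_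
  obtain ⟨s, hs0, hs1, hs2⟩ := h.exists_sqrt
  obtain ⟨l, r, hlr, hI, -⟩ := hp.1.exists_Icc
  have hlI : alpha0 a ≤ l := (hp.2.1 (hI ▸ ⟨le_rfl, hlr.le⟩)).1
  have hsα : alpha0 a + 1 / 4 < -s := by rw [h.alpha0_eq]; linarith
  rw [h.sMinus_eq hs0 hs2, hI]
  rw [hI] at hz
  have hz2 := (abs_lt.1 hd).2
  have hl2 : l < -s := by linarith [hz.1]
  refine ⟨l, ⟨⟨hlI, hl2.le⟩, le_rfl, hlr.le⟩, min r (-s), ⟨⟨?_, min_le_right _ _⟩, ?_,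
    min_le_left _ _⟩, (lt_min hlr hl2).ne⟩
  · exact le_min (hlI.trans hlr.le) (hlI.trans hl2.le)
  · exact (lt_min hlr hl2).le

theorem NearTwo.eq_sPlus (h : NearTwo a b) {p : OrdSet} (hp : IsPrimePiece a p) {z : ℝ}
    (hz : z ∈ p.1) (hd : |z + alpha0 a| < 1 / 4) : p = sPlus a 2 := by
  refine h.prime_eq_of_le h.sPlus_isPuzzlePiece h.sPlus_ssubset hp (h.two_le_order hp) ?_
  obtain ⟨s, hs0, hs1, hs2⟩ := h.exists_sqrt
  obtain ⟨l, r, hlr, hI, -⟩ := hp.1.exists_Icc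
  have hrI : r ≤ -alpha0 a := (hp.2.1 (hI ▸ ⟨hlr.le, le_rfl⟩)).2
  have hsα : s < -alpha0 a - 1 / 4 := by rw [h.alpha0_eq]; linarith
  rw [h.sPlus_eq hs0 hs2, hI]
  rw [hI] at hz
  have hz2 := (abs_lt.1 hd).1
  have hr2 : s < r := by linarith [hz.2]
  refine ⟨max l s, ⟨⟨le_max_right _ _, ?_⟩, le_max_left _ _, ?_⟩, r, ⟨⟨hr2.le, hrI⟩, hlr.le,
    le_rfl⟩, (max_lt hlr hr2).ne⟩
  · exact max_le (hlr.le.trans hrI) (hr2.le.trans hrI)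
  · exact (max_lt hlr hr2).le

end QuadPuzzle

namespace QuadPuzzle

open Set Finset

variable {a b : ℝ} {M : ℕ} {p : ℕ → OrdSet} {x : ℝ}

/-! ### The orbit of the critical value -/

/-- The order of the product of the first `k` pieces of a sequence. -/
def orderSum (p : ℕ → OrdSet) (k : ℕ) : ℕ := ∑ j ∈ Finset.range k, (p j).2

open Classical in
/-- The total order of the simple pieces among the first `k` ones. -/
noncomputable def simpleSum (a : ℝ) (M : ℕ) (p : ℕ → OrdSet) (k : ℕ) : ℕ :=
  ∑ j ∈ Finset.range k, if IsSimplePiece a M (p j) then (p j).2 else 0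

open Classical in
/-- The total order of the pieces that are not simple among the first `k` ones. -/
noncomputable def nonsimpleSum (a : ℝ) (M : ℕ) (p : ℕ → OrdSet) (k : ℕ) : ℕ :=
  ∑ j ∈ Finset.range k, if IsSimplePiece a M (p j) then 0 else (p j).2

theorem orderSum_succ (p : ℕ → OrdSet) (k : ℕ) :
    orderSum p (k + 1) = orderSum p k + (p k).2 := Finset.sum_range_succ _ _

theorem simpleSum_add_nonsimpleSum (a : ℝ) (M : ℕ) (p : ℕ → OrdSet) (k : ℕ) :
    simpleSum a M p k + nonsimpleSum a M p k = orderSum p k := by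
  rw [simpleSum, nonsimpleSum, orderSum, ← sum_add_distrib]
  refine sum_congr rfl fun j _ => ?_
  split_ifs <;> simp

theorem take_map_range (p : ℕ → OrdSet) {j k : ℕ} (hjk : j ≤ k) :
    ((List.range k).map p).take j = (List.range j).map p := by
  rw [← List.map_take, List.take_range, min_eq_left hjk]

theorem totalOrder_map_range (p : ℕ → OrdSet) (k : ℕ) :
    totalOrder ((List.range k).map p) = orderSum p k := by
  induction k with
  | zero => rfl
  | succ k ih => rw [orderSum_succ, ← ih]; simp [totalOrder, List.range_succ]

open Classical in
theorem totalOrder_filter_map_range (a : ℝ) (M : ℕ) (p : ℕ → OrdSet) (k : ℕ) :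
    totalOrder (((List.range k).map p).filter fun q => ¬ IsSimplePiece a M q) =
      nonsimpleSum a M p k := by
  induction k with
  | zero => rfl
  | succ k ih =>
    rw [nonsimpleSum, Finset.sum_range_succ, ← nonsimpleSum, ← ih]
    by_cases hs : IsSimplePiece a M (p k) <;> simp [totalOrder, List.range_succ, hs]

/-- The properties of the sequence of pieces around the critical value of a strongly regular map,
and of the point `x = P_a ^ M (a)`, that give the Collet–Eckmann condition. -/
structure StrongOrbit (a : ℝ) (M : ℕ) (p : ℕ → OrdSet) (x : ℝ) : Prop where
  prime : ∀ j, IsPrimePiece a (p j)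
  mem : ∀ j, (P a)^[orderSum p j] x ∈ (p j).1
  not_minus : ∀ j, ¬ ∀ i < aleph M (orderSum p j), p (j + i) = sMinus a 2
  not_plus : ∀ j, p j = sPlus a 2 →
    ¬ ∀ i < aleph M (orderSum p j), p (j + 1 + i) = sMinus a 2
  sparse : ∀ k, (nonsimpleSum a M p k : ℝ) ≤ (2 : ℝ) ^ (-√(M : ℝ)) * orderSum p k

theorem drop_take_map_range (p : ℕ → OrdSet) (j m : ℕ) :
    (((List.range (j + m)).map p).drop j).take m = (List.range m).map fun i => p (j + i) := by
  refine List.ext_getElem (by simp) fun i h1 h2 => ?_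
  simp

/-- Commonness refers to some prime decomposition; by uniqueness it is the sequence itself, so the
forbidden products become forbidden strings of pieces. -/
theorem NearTwo.exists_strongOrbit (h : NearTwo a b) (hM : 24 ≤ M)
    (hSR : IsStronglyRegular a M) : ∃ p, StrongOrbit a M p ((P a)^[M + 1] 0) := by
  obtain ⟨p, hp, hk⟩ := hSR
  have hpuz : ∀ k, 1 ≤ k → IsPuzzlePiece a (starProd a ((List.range k).map p)) :=
    fun k h1 => (hk k h1).2.2.1.1
  have hprime := h.prime_of_depth hp hpuz fun k h1 => (hk k h1).2.2.2
  have hcommon : ∀ k, 1 ≤ k → ∀ j m' : ℕ, m' = aleph M (orderSum p j) → j ≤ k →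
      (j + m' ≤ k → starProd a ((((List.range k).map p).drop j).take m') ≠
        starProd a (List.replicate m' (sMinus a 2))) ∧
      (j + m' + 1 ≤ k → starProd a ((((List.range k).map p).drop j).take (m' + 1)) ≠
        starProd a (sPlus a 2 :: List.replicate m' (sMinus a 2))) := by
    intro k h1 j m' hm' hj
    obtain ⟨L, ⟨hL, hLe⟩, hL'⟩ := (hk k h1).2.2.1.2
    obtain rfl : L = (List.range k).map p :=
      h.starProd_inj hL (hprime k) hLe (hLe ▸ (hpuz k h1).nontrivial)
    have := hL' j m' (by rw [take_map_range p hj, totalOrder_map_range, hm'])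
    simpa using this
  -- Needed at j = 0, where the product of the first j + m pieces must be nonempty.
  have haleph : ∀ N, 1 ≤ aleph M N := by
    intro N
    rw [aleph, Nat.one_le_floor_iff]
    have : (24 : ℝ) ≤ M := by exact_mod_cast hM
    have : (0 : ℝ) ≤ N := Nat.cast_nonneg N
    linarith
  refine ⟨p, fun j => hprime (j + 1) _ (List.mem_map_of_mem (by simp)), fun j => ?_, fun j hj => ?_,
    fun j hpj hj => ?_, fun k => ?_⟩
  · have := mem_starProd_getElem (hk (j + 1) (by omega)).1 j (by simp)
    rw [take_map_range p (by omega), totalOrder_map_range] at this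
    simpa using this
  · have h1 := haleph (orderSum p j)
    set m := aleph M (orderSum p j)
    refine (hcommon (j + m) (by omega) j m rfl (by omega)).1 le_rfl ?_
    rw [drop_take_map_range]
    congr 1
    exact List.ext_getElem (by simp) fun i h2 h3 => by simpa using hj i (by simpa using h2)
  · set m := aleph M (orderSum p j)
    refine (hcommon (j + (m + 1)) (by omega) j m rfl (by omega)).2 (by omega) ?_
    rw [drop_take_map_range]
    congr 1
    refine List.ext_getElem (by simp) fun i h2 h3 => ?_
    cases i with
    | zero => simpa using hpj
    | succ i =>
      have := hj i (by simpa using h2)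
      simpa [add_assoc, add_comm 1 i] using this
  · rcases Nat.eq_zero_or_pos k with rfl | hk0
    · simp [nonsimpleSum, orderSum]
    · have := (hk k hk0).2.1.2 k hk0 (by simp)
      rw [take_map_range p le_rfl, totalOrder_map_range] at this
      rw [← totalOrder_filter_map_range]
      convert this using 3

theorem StrongOrbit.mem_Ieps (ho : StrongOrbit a M p x) (j : ℕ) :
    (P a)^[orderSum p j] x ∈ Ieps a := (ho.prime j).2.1 (ho.mem j)

/-! ### Distance of the critical orbit from ±α₀ -/

/-- Each s_- block applies P² and multiplies the distance to α₀ by at most 16, so m blocks keep it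
below 1/4. -/
theorem StrongOrbit.eq_sMinus_of_near (ho : StrongOrbit a M p x) (h : NearTwo a b) {j m : ℕ}
    (hd : |(P a)^[orderSum p j] x - alpha0 a| < 1 / 4 * (1 / 16) ^ m) :
    ∀ i ≤ m, p (j + i) = sMinus a 2 := by
  have hα : alpha0 a ∈ Ieps a :=
    ⟨le_rfl, (ho.mem_Ieps j).1.trans (ho.mem_Ieps j).2⟩
  have hlt : ∀ i ≤ m, ∀ d : ℝ, d ≤ 16 ^ i * |(P a)^[orderSum p j] x - alpha0 a| → d < 1 / 4 := by
    intro i hi d hd'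
    calc d ≤ 16 ^ i * |(P a)^[orderSum p j] x - alpha0 a| := hd'
      _ < 16 ^ i * (1 / 4 * (1 / 16) ^ m) := by gcongr
      _ ≤ 16 ^ m * (1 / 4 * (1 / 16) ^ m) := by gcongr; norm_num
      _ = 1 / 4 * (16 * (1 / 16)) ^ m := by rw [mul_pow]; ring
      _ = 1 / 4 := by norm_num
  have hdist : ∀ i ≤ m, |(P a)^[orderSum p (j + i)] x - alpha0 a| ≤
      16 ^ i * |(P a)^[orderSum p j] x - alpha0 a| := by
    intro i
    induction i with
    | zero => simp
    | succ i ih =>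
      intro hi
      have ih := ih (by omega)
      have hp := h.eq_sMinus (ho.prime (j + i)) (ho.mem (j + i)) (hlt i (by omega) _ ih)
      have h2 : (p (j + i)).2 = 2 := by rw [hp]; rfl
      have := h.lipschitz 2 (h.Ieps_subset (ho.mem_Ieps (j + i))) (h.Ieps_subset hα)
      rw [h.iterate_alpha0, ← Function.iterate_add_apply] at this
      rw [← add_assoc, orderSum_succ, h2, add_comm _ 2, pow_succ]
      linarith
  exact fun i hi => h.eq_sMinus (ho.prime _) (ho.mem _) (hlt i hi _ (hdist i hi))

theorem StrongOrbit.le_dist (ho : StrongOrbit a M p x) (h : NearTwo a b) (j : ℕ) :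
    1 / 4 * (1 / 16) ^ (aleph M (orderSum p j) + 1) ≤ |(P a)^[orderSum p j] x - alpha0 a| ∧
    1 / 4 * (1 / 16) ^ (aleph M (orderSum p j) + 1) ≤ |(P a)^[orderSum p j] x + alpha0 a| := by
  constructor
  · by_contra! hc
    exact ho.not_minus j fun i hi => ho.eq_sMinus_of_near h hc i (by omega)
  · by_contra! hc
    have hlt : |(P a)^[orderSum p j] x + alpha0 a| < 1 / 4 := hc.trans_le <| by
      have : ((1 : ℝ) / 16) ^ (aleph M (orderSum p j) + 1) ≤ 1 :=
        pow_le_one₀ (by norm_num) (by norm_num)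
      linarith
    have hp := h.eq_sPlus (ho.prime j) (ho.mem j) hlt
    -- The initial s_+ block carries -α₀ to α₀ and costs one factor 16, hence the exponent ℵ + 1.
    refine ho.not_plus j hp fun i hi => ho.eq_sMinus_of_near h (j := j + 1) ?_ i hi.le
    have h2 : (p j).2 = 2 := by rw [hp]; rfl
    have hα : -alpha0 a ∈ Ieps a :=
      ⟨(ho.mem_Ieps j).1.trans (ho.mem_Ieps j).2, le_rfl⟩
    have := h.lipschitz 2 (h.Ieps_subset (ho.mem_Ieps j)) (h.Ieps_subset hα)
    rw [h.iterate_of_abs_eq two_ne_zero (Or.inr rfl), ← Function.iterate_add_apply,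
      sub_neg_eq_add] at this
    rw [orderSum_succ, h2, add_comm _ 2]
    rw [pow_succ] at hc
    linarith

theorem aleph_le (M N : ℕ) : aleph M N ≤ N + M := by
  have h1 : (aleph M N : ℝ) ≤ (N : ℝ) / 12 + (M : ℝ) / 24 := Nat.floor_le (by positivity)
  have h2 : (0 : ℝ) ≤ N := Nat.cast_nonneg N
  have h3 : (0 : ℝ) ≤ M := Nat.cast_nonneg M
  have : (aleph M N : ℝ) ≤ ((N + M : ℕ) : ℝ) := by push_cast; linarith
  exact_mod_cast this

/-- With s = √M ≥ 1000, the fourth-order term of the exponential gives 2^s ≥ s⁴/384 ≥ 1000 s². -/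
theorem two_rpow_neg_sqrt_mul_le (hM : 10 ^ 6 ≤ M) : (2 : ℝ) ^ (-√(M : ℝ)) * M ≤ 1 / 1000 := by
  have hM' : (10 ^ 6 : ℝ) ≤ M := by exact_mod_cast hM
  have hs : 1000 ≤ √(M : ℝ) := Real.le_sqrt_of_sq_le (by norm_num; linarith)
  have hsq := Real.sq_sqrt (Nat.cast_nonneg (α := ℝ) M)
  set s := √(M : ℝ)
  have hlog : 1 / 2 ≤ Real.log 2 := by linarith [Real.log_two_gt_d9]
  have h1 : s ^ 4 / 384 ≤ (2 : ℝ) ^ s := by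
    rw [Real.rpow_def_of_pos two_pos]
    have h2 := Real.pow_div_factorial_le_exp (Real.log 2 * s) (by positivity) 4
    refine le_trans ?_ h2
    have h3 : (1 / 2 * s) ^ 4 ≤ (Real.log 2 * s) ^ 4 := by gcongr
    have h4 : ((Nat.factorial 4 : ℕ) : ℝ) = 24 := by norm_num [Nat.factorial]
    rw [h4]
    calc s ^ 4 / 384 = (1 / 2 * s) ^ 4 / 24 := by ring
      _ ≤ _ := by gcongr
  rw [Real.rpow_neg two_pos.le, inv_mul_le_iff₀ (by positivity), ← hsq]
  have : (1000 : ℝ) ^ 2 ≤ s ^ 2 := by gcongr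
  nlinarith [sq_nonneg s]

theorem two_rpow_neg_sqrt_le (hM : 10 ^ 6 ≤ M) : (2 : ℝ) ^ (-√(M : ℝ)) ≤ 1 / 1000 := by
  have hM' : (10 ^ 6 : ℝ) ≤ M := by exact_mod_cast hM
  have h0 : (0 : ℝ) < (2 : ℝ) ^ (-√(M : ℝ)) := by positivity
  nlinarith [two_rpow_neg_sqrt_mul_le hM]

/-- A simple piece has order below M; any other is itself counted in the sparse sum. -/
theorem StrongOrbit.order_le (ho : StrongOrbit a M p x) (j : ℕ) :
    ((p j).2 : ℝ) ≤ M + (2 : ℝ) ^ (-√(M : ℝ)) * orderSum p (j + 1) := by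
  by_cases hs : IsSimplePiece a M (p j)
  · have h1 : (p j).2 ≤ M := by
      obtain ⟨i, -, hi, he | he⟩ := hs <;> rw [he]
      · exact hi.trans (Nat.sub_le _ _)
      · exact hi.trans (Nat.sub_le _ _)
    have h2 : ((p j).2 : ℝ) ≤ M := by exact_mod_cast h1
    have : 0 ≤ (2 : ℝ) ^ (-√(M : ℝ)) * orderSum p (j + 1) := by positivity
    linarith
  · have h1 : (p j).2 ≤ nonsimpleSum a M p (j + 1) := by
      rw [nonsimpleSum, Finset.sum_range_succ, if_neg hs]; omega
    have h2 : ((p j).2 : ℝ) ≤ nonsimpleSum a M p (j + 1) := by exact_mod_cast h1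
    linarith [ho.sparse (j + 1), Nat.cast_nonneg (α := ℝ) M]

theorem StrongOrbit.le_orderSum (ho : StrongOrbit a M p x) (h : NearTwo a b) (k : ℕ) :
    k ≤ orderSum p k := by
  induction k with
  | zero => simp
  | succ k ih => rw [orderSum_succ]; have := h.two_le_order (ho.prime k); omega

/-- The first product of the sequence whose order is at least `n`. -/
theorem StrongOrbit.exists_orderSum (ho : StrongOrbit a M p x) (h : NearTwo a b) (n : ℕ) :
    ∃ k, n ≤ orderSum p k ∧
      (orderSum p k : ℝ) ≤ n + M + (2 : ℝ) ^ (-√(M : ℝ)) * orderSum p k := by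
  have hex : ∃ k, n ≤ orderSum p k := ⟨n, ho.le_orderSum h n⟩
  classical
  refine ⟨Nat.find hex, Nat.find_spec hex, ?_⟩
  rcases hk : Nat.find hex with _ | k
  · simp only [orderSum, Finset.range_zero, Finset.sum_empty]; push_cast; positivity
  · have h1 : orderSum p k < n := not_le.1 (Nat.find_min hex (by omega : k < Nat.find hex))
    have h2 : (orderSum p k : ℝ) ≤ n := by exact_mod_cast h1.le
    have h3 : (orderSum p (k + 1) : ℝ) = orderSum p k + (p k).2 := by
      rw [orderSum_succ]; push_cast; rfl
    linarith [ho.order_le k]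

/-- The bound at a block end is pulled back to time m by the Lipschitz constant 4 of P, as ±α₀ maps
to α₀. -/
theorem StrongOrbit.le_dist_critical (ho : StrongOrbit a M p ((P a)^[M + 1] 0))
    (h : NearTwo a b) (hM : 10 ^ 6 ≤ M) {m : ℕ} (hm : 1 ≤ m) :
    (1 / 16) ^ (5 * M * m) ≤ |(P a)^[m] 0 - alpha0 a| ∧
    (1 / 16) ^ (5 * M * m) ≤ |(P a)^[m] 0 + alpha0 a| := by
  obtain ⟨j, hmj, hj⟩ : ∃ j, m ≤ M + orderSum p j ∧ orderSum p j ≤ 2 * m := by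
    rcases le_or_gt m M with hmM | hmM
    · exact ⟨0, by omega, by simp [orderSum]⟩
    · obtain ⟨k, hk1, hk2⟩ := ho.exists_orderSum h (m - M)
      refine ⟨k, by omega, ?_⟩
      have h1 := two_rpow_neg_sqrt_le hM
      push_cast [Nat.cast_sub hmM.le] at hk2
      have h2 : (0 : ℝ) ≤ orderSum p k := Nat.cast_nonneg _
      have : (orderSum p k : ℝ) ≤ ((2 * m : ℕ) : ℝ) := by push_cast; nlinarith
      exact_mod_cast this
  set N := orderSum p j with hN
  obtain ⟨t, ht⟩ : ∃ t, M + 1 + N = t + 1 + m := ⟨M + N - m, by omega⟩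
  have hit : (P a)^[t + 1] ((P a)^[m] 0) = (P a)^[N] ((P a)^[M + 1] 0) := by
    rw [← Function.iterate_add_apply, ← Function.iterate_add_apply, ← ht, add_comm]
  have h0 : (P a)^[m] 0 ∈ Icc (-b) b := h.mapsTo_iterate m (h.Ieps_subset h.zero_mem)
  have hmem := ho.mem_Ieps 0
  have hα : alpha0 a ∈ Ieps a := ⟨le_rfl, hmem.1.trans hmem.2⟩
  have hα' : -alpha0 a ∈ Ieps a := ⟨hmem.1.trans hmem.2, le_rfl⟩
  have hal := aleph_le M N
  have key : ∀ d : ℝ, 1 / 4 * (1 / 16) ^ (aleph M N + 1) ≤ 4 ^ (t + 1) * d →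
      (1 / 16) ^ (5 * M * m) ≤ d := by
    intro d hd
    have h1 : (1 / 16 : ℝ) ^ (5 * M * m) ≤ (1 / 16) ^ (t + 1 + 1 + (aleph M N + 1)) := by
      -- With t = M + N - m, ℵ ≤ N + M and N ≤ 2m, the exponent is at most 2M + 3m + 3 ≤ 5Mm.
      refine pow_le_pow_of_le_one (by norm_num) (by norm_num) ?_
      nlinarith
    have h2 : (1 / 16 : ℝ) ^ (t + 1) ≤ (1 / 4) ^ (t + 1) := by gcongr; norm_num
    have h3 : (4 : ℝ) ^ (t + 1) * (1 / 4) ^ (t + 1) = 1 := by rw [← mul_pow]; norm_num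
    calc (1 / 16 : ℝ) ^ (5 * M * m) ≤ (1 / 16) ^ (t + 1) * (1 / 16) * (1 / 16) ^ (aleph M N + 1) := by
          rw [← pow_succ, ← pow_add]; exact h1
      _ ≤ (1 / 4) ^ (t + 1) * (1 / 4) * (1 / 16) ^ (aleph M N + 1) := by gcongr; norm_num
      _ = (1 / 4) ^ (t + 1) * (1 / 4 * (1 / 16) ^ (aleph M N + 1)) := by ring
      _ ≤ (1 / 4) ^ (t + 1) * (4 ^ (t + 1) * d) := by gcongr
      _ = (4 ^ (t + 1) * (1 / 4) ^ (t + 1)) * d := by ring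
      _ = d := by rw [h3, one_mul]
  have hle := (ho.le_dist h j).1
  rw [← hN, ← hit] at hle
  constructor
  · refine key _ (hle.trans ?_)
    have := h.lipschitz (t + 1) h0 (h.Ieps_subset hα)
    rwa [h.iterate_alpha0] at this
  · refine key _ (hle.trans ?_)
    have := h.lipschitz (t + 1) h0 (h.Ieps_subset hα')
    rwa [h.iterate_of_abs_eq (Nat.succ_ne_zero t) (Or.inr rfl), sub_neg_eq_add] at this

/-! ### Growth of the derivative along the critical orbit -/

theorem StrongOrbit.nonsimple_expansion (ho : StrongOrbit a M p ((P a)^[M + 1] 0))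
    (h : NearTwo a b) (hM : 10 ^ 6 ≤ M) {q : OrdSet} (hq : IsPrimePiece a q) {y : ℝ}
    (hy : y ∈ q.1) : (1 / 16) ^ (11 * M * q.2) ≤ |deriv (P a)^[q.2] y| := by
  obtain ⟨l, r, hlr, hI, hl, hr, -⟩ := hq.1.exists_Icc
  have h2 := h.two_le_order hq
  have hlm : l ∈ q.1 := hI ▸ ⟨le_rfl, hlr.le⟩
  have hrm : r ∈ q.1 := hI ▸ ⟨hlr.le, le_rfl⟩
  have hlI := (hq.2.1 hlm).1
  have hrI := (hq.2.1 hrm).2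
  rw [h.alpha0_eq] at hlI hrI
  have hpos : 1 ≤ M * q.2 := Nat.mul_pos (by omega) (by omega)
  have hδ : (1 / 16 : ℝ) ^ (5 * M * q.2) ≤ 1 / 2 := by
    refine (pow_le_pow_of_le_one (n := 5 * M * q.2) (m := 1) (by norm_num) (by norm_num) ?_).trans
      (by norm_num)
    nlinarith
  rw [hI] at hy
  refine le_trans ?_ (h.branch_expansion (δ := (1 / 16) ^ (5 * M * q.2)) (by omega : q.2 ≠ 0)
    (by linarith) hy.1 hy.2 (by linarith)
    (fun k hk z hz => hq.1.iterate_ne_zero hk (hI ▸ hz)) hl hr (by positivity) hδ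
    fun m h1 hmn => ?_)
  -- Squaring δ doubles the exponent 5Mn, and one more factor 1/16 absorbs the 1/4.
  · calc (1 / 16 : ℝ) ^ (11 * M * q.2) ≤ (1 / 16) ^ (5 * M * q.2 + 5 * M * q.2 + 1) := by
          refine pow_le_pow_of_le_one (by norm_num) (by norm_num) ?_
          nlinarith
      _ = ((1 / 16) ^ (5 * M * q.2)) ^ 2 * (1 / 16) := by rw [pow_succ, pow_add, sq]
      _ ≤ _ := by
        have : (0 : ℝ) ≤ ((1 / 16) ^ (5 * M * q.2)) ^ 2 := by positivity
        linarith
  · have hle : (1 / 16 : ℝ) ^ (5 * M * q.2) ≤ (1 / 16) ^ (5 * M * m) :=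
      pow_le_pow_of_le_one (by norm_num) (by norm_num) (by gcongr)
    have := ho.le_dist_critical h hM h1
    exact ⟨hle.trans this.1, hle.trans this.2⟩

theorem StrongOrbit.simple_expansion (ho : StrongOrbit a M p x) (h : NearTwo a b)
    (hα : ∀ i, i + 2 ≤ M → 2 * (a + b) ≤ alpha a i + b) {j : ℕ}
    (hs : IsSimplePiece a M (p j)) :
    (7 / 5) ^ (p j).2 ≤ |deriv (P a)^[(p j).2] ((P a)^[orderSum p j] x)| := by
  have hmem := ho.mem j
  have hend := (ho.prime j).1.mapsTo hmem
  obtain ⟨i, h2, hi, he⟩ := hs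
  have hi' : (p j).2 = i := by rcases he with he | he <;> rw [he] <;> rfl
  have hP : P a ((P a)^[orderSum p j] x) ∈ Icc (alpha a (i - 1)) (alpha a (i - 2)) := by
    rcases he with he | he <;> rw [he] at hmem <;> exact hmem.2
  rw [hi'] at hend ⊢
  exact h.simple_expansion h2 (hα _ (by omega)) hP hend

theorem StrongOrbit.expansion (ho : StrongOrbit a M p ((P a)^[M + 1] 0)) (h : NearTwo a b)
    (hα : ∀ i, i + 2 ≤ M → 2 * (a + b) ≤ alpha a i + b) (hM : 10 ^ 6 ≤ M) (k : ℕ) :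
    (7 / 5) ^ simpleSum a M p k * (1 / 16) ^ (11 * M * nonsimpleSum a M p k) ≤
      |deriv (P a)^[orderSum p k] ((P a)^[M + 1] 0)| := by
  induction k with
  | zero => simp [simpleSum, nonsimpleSum, orderSum]
  | succ k ih =>
    rw [orderSum_succ, deriv_iterate_P_add, abs_mul]
    rw [simpleSum, nonsimpleSum, Finset.sum_range_succ, Finset.sum_range_succ, ← simpleSum,
      ← nonsimpleSum]
    by_cases hs : IsSimplePiece a M (p k)
    · rw [if_pos hs, if_pos hs, add_zero, pow_add, mul_right_comm]
      exact mul_le_mul ih (ho.simple_expansion h hα hs) (by positivity) (abs_nonneg _)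
    · rw [if_neg hs, if_neg hs, add_zero, mul_add, pow_add, ← mul_assoc]
      exact mul_le_mul ih (ho.nonsimple_expansion h hM (ho.prime k) (ho.mem k)) (by positivity)
        (abs_nonneg _)

theorem StrongOrbit.log_expansion (ho : StrongOrbit a M p ((P a)^[M + 1] 0)) (h : NearTwo a b)
    (hα : ∀ i, i + 2 ≤ M → 2 * (a + b) ≤ alpha a i + b) (hM : 10 ^ 6 ≤ M) (k : ℕ) :
    deriv (P a)^[orderSum p k] ((P a)^[M + 1] 0) ≠ 0 ∧
    (orderSum p k : ℝ) / 5 ≤ Real.log |deriv (P a)^[orderSum p k] ((P a)^[M + 1] 0)| := by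
  have hexp := ho.expansion h hα hM k
  have hpos : (0 : ℝ) < (7 / 5) ^ simpleSum a M p k * (1 / 16) ^ (11 * M * nonsimpleSum a M p k) := by
    positivity
  refine ⟨abs_pos.1 (hpos.trans_le hexp), ?_⟩
  refine le_trans ?_ (Real.log_le_log hpos hexp)
  rw [Real.log_mul (by positivity) (by positivity), Real.log_pow, Real.log_pow]
  have h1 : 2 / 7 ≤ Real.log (7 / 5) := by
    have := Real.one_sub_inv_le_log_of_pos (show (0 : ℝ) < 7 / 5 by norm_num)
    norm_num at this ⊢; linarith
  have h2 : -3 ≤ Real.log (1 / 16) := by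
    rw [one_div, Real.log_inv, show (16 : ℝ) = 2 ^ 4 by norm_num, Real.log_pow]
    have := Real.log_two_lt_d9
    push_cast; linarith
  have hsum : (simpleSum a M p k : ℝ) + nonsimpleSum a M p k = orderSum p k := by
    exact_mod_cast simpleSum_add_nonsimpleSum a M p k
  have hsp := ho.sparse k
  have he := two_rpow_neg_sqrt_le hM
  have heM := two_rpow_neg_sqrt_mul_le hM
  set A : ℝ := (simpleSum a M p k : ℝ)
  set B : ℝ := (nonsimpleSum a M p k : ℝ)
  set N : ℝ := (orderSum p k : ℝ)
  set ε : ℝ := (2 : ℝ) ^ (-√(M : ℝ))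
  have hA : 0 ≤ A := Nat.cast_nonneg _
  have hB : 0 ≤ B := Nat.cast_nonneg _
  have hN : 0 ≤ N := Nat.cast_nonneg _
  have hM0 : (0 : ℝ) ≤ M := Nat.cast_nonneg _
  -- The loss is at most 33·M·B ≤ 0.033 N, against a gain of at least (2/7)·0.999 N; the balance
  -- exceeds N/5.
  have hMB : (M : ℝ) * B ≤ 1 / 1000 * N := by
    calc (M : ℝ) * B ≤ M * (ε * N) := by gcongr
      _ = (ε * M) * N := by ring
      _ ≤ _ := by gcongr
  have hBN : B ≤ 1 / 1000 * N := hsp.trans (by gcongr)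
  have e1 : A * (2 / 7) ≤ A * Real.log (7 / 5) := by gcongr
  have e2 : (11 * (M * B)) * (-3) ≤ (11 * (M * B)) * Real.log (1 / 16) := by gcongr
  push_cast
  have e3 : (11 * (M : ℝ) * B) * Real.log (1 / 16) = (11 * (M * B)) * Real.log (1 / 16) := by ring
  linarith

/-- Growth holds at the first block end n + t ≥ n; the last t steps contribute at most t log 4, and
t ≤ M + (n + t)/1000. -/
theorem StrongOrbit.log_deriv_ge (ho : StrongOrbit a M p ((P a)^[M + 1] 0)) (h : NearTwo a b)
    (hα : ∀ i, i + 2 ≤ M → 2 * (a + b) ≤ alpha a i + b) (hM : 10 ^ 6 ≤ M) (n : ℕ) :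
    deriv (P a)^[n] ((P a)^[M + 1] 0) ≠ 0 ∧
    (n : ℝ) / 10 - 2 * M ≤ Real.log |deriv (P a)^[n] ((P a)^[M + 1] 0)| := by
  obtain ⟨k, hk, hk'⟩ := ho.exists_orderSum h n
  obtain ⟨hne, hlog⟩ := ho.log_expansion h hα hM k
  obtain ⟨t, ht⟩ := Nat.exists_eq_add_of_le hk
  have he := two_rpow_neg_sqrt_le hM
  have hx : (P a)^[M + 1] 0 ∈ Icc (-b) b := h.Ieps_subset (ho.mem_Ieps 0)
  rw [ht, deriv_iterate_P_add] at hne hlog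
  have h1 := left_ne_zero_of_mul hne
  have h2 := right_ne_zero_of_mul hne
  refine ⟨h1, ?_⟩
  rw [abs_mul, Real.log_mul (abs_ne_zero.2 h1) (abs_ne_zero.2 h2)] at hlog
  have h3 := Real.log_le_log (abs_pos.2 h2) (h.abs_deriv_le t (h.mapsTo_iterate n hx))
  rw [Real.log_pow, show (4 : ℝ) = 2 ^ 2 by norm_num, Real.log_pow] at h3
  have h4 := Real.log_two_lt_d9
  rw [ht] at hk'
  push_cast at h3 hlog hk'
  have hn : (0 : ℝ) ≤ n := Nat.cast_nonneg _
  have ht0 : (0 : ℝ) ≤ t := Nat.cast_nonneg _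
  have h5 : (t : ℝ) * (2 * Real.log 2) ≤ t * (7 / 5) := by gcongr; linarith
  have h6 : (2 : ℝ) ^ (-√(M : ℝ)) * (n + t) ≤ 1 / 1000 * (n + t) := by gcongr
  have hM0 : (0 : ℝ) ≤ M := Nat.cast_nonneg _
  linarith

end QuadPuzzle

/-! ### The Collet–Eckmann condition -/

theorem corollary3p27 (a : ℝ) (M : ℕ) (ha : -2 < a)
    (hM : QuadPuzzle.IsFirstReturnTime a M) (hM_large : 10 ^ 6 ≤ M)
    (hSR : QuadPuzzle.IsStronglyRegular a M) :
    QuadPuzzle.ColletEckmann a := by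
  obtain ⟨b, h, hα⟩ := hM.exists_nearTwo ha (by omega)
  obtain ⟨p, ho⟩ := h.exists_strongOrbit (by omega) hSR
  have hDM : deriv (QuadPuzzle.P a)^[M] a ≠ 0 := by
    rw [QuadPuzzle.deriv_iterate_ne_zero_iff]
    exact fun k hk h0 => hM.2 k hk (h0 ▸ h.zero_mem)
  have hx : (QuadPuzzle.P a)^[M + 1] 0 = (QuadPuzzle.P a)^[M] a := by
    rw [Function.iterate_succ_apply]; simp [QuadPuzzle.P]
  set C := Real.log |deriv (QuadPuzzle.P a)^[M] a|
  have hlow : ∀ᶠ n : ℕ in Filter.atTop, ((1 / 20 : ℝ) : EReal) ≤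
      (((1 / (n : ℝ)) * Real.log |deriv (QuadPuzzle.P a)^[n] a| : ℝ) : EReal) := by
    filter_upwards [Filter.eventually_ge_atTop (M + 1),
      -- With n = M + t, this threshold makes C + t/10 - 2M at least n/20.
      tendsto_natCast_atTop_atTop.eventually_ge_atTop (20 * (3 * (M : ℝ) - C))] with n hn hn'
    obtain ⟨t, rfl⟩ := Nat.exists_eq_add_of_le (show M ≤ n by omega)
    obtain ⟨hne, hlog⟩ := ho.log_deriv_ge h hα hM_large t
    rw [hx] at hne hlog
    rw [EReal.coe_le_coe_iff, QuadPuzzle.deriv_iterate_P_add, abs_mul,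
      Real.log_mul (abs_ne_zero.2 hDM) (abs_ne_zero.2 hne), one_div_mul_eq_div,
      le_div_iff₀ (by exact_mod_cast (by omega : 0 < M + t))]
    push_cast at hn' ⊢
    have hM0 : (0 : ℝ) ≤ M := Nat.cast_nonneg _
    linarith
  refine lt_of_lt_of_le ?_ (Filter.le_liminf_of_le (by isBoundedDefault) hlow)
  exact_mod_cast (by norm_num : (0 : ℝ) < 1 / 20)
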